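/- Let $(\Omega',\mathcal F',\mathbf P')$ and $(\Omega,\mathcal F,\mathbf P)$ be probability spaces. Let $Y=(Y_t)_{t\ge 0}$ be a fractional Brownian motion on $(\Omega',\mathcal F',\mathbf P')$ with Hurst exponent $H'\in(0,1)$ and variance $v>0$ at time one, i.e. a centered Gaussian process with covariance $\mathbf E'[Y_sY_t]=\frac v2\left(s^{2H'}+t^{2H'}-|s-t|^{2H'}\right)$ and almost surely continuous paths. Let $M_1$ be a Gaussian random measure (the case $\alpha=2$ of a symmetric $\alpha$-stable random measure) on $\Omega'\times\mathbb R$, defined on $(\Omega,\mathcal F,\mathbf P)$, with control measure $\mathbf P'\times\mathrm{Leb}$: for measurable $A$ of finite control measure, $M_1(A)$ is a centered Gaussian variable with variance $(\mathbf P'\times\mathrm{Leb})(A)$, the values of $M_1$ on disjoint sets are independent, and $M_1$ is almost surely $\sigma$-additive. For $f\in L^2(\mathbf P'\times\mathrm{Leb})$, $\int f\,dM_1$ is the $L^2(\mathbf P)$-limit of the integrals of elementary functions approximating $f$ in $L^2$. Write $[0,y]$ for the closed interval between $0$ and $y$ whatever the sign of $y$, and for $s\ge 0$ let $\tau_s=\inf\{t\ge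 0: Y_t=s\}$. Then $\tau_s<\infty$ $\mathbf P'$-almost surely for each $s\ge0$, the integrals $$Y^{(\times)}_t=\int_{\Omega'\times\mathbb R}1_{[0,Y_t(\omega')]}(x)\,M_1(d\omega'\times dx),\qquad Y^{(\times)_\tau}_t=\int_{\Omega'\times\mathbb R}1_{[0,Y_{\tau_t}(\omega')]}(x)\,M_1(d\omega'\times dx)\qquad(t\ge 0)$$ are well defined, and: 1. $(Y^{(\times)}_t)_{t\ge0}$ is, up to modification, a fractional Brownian motion with Hurst exponent $H'/2<1/2$ and variance $\mathbf E'|Y_1|$ at time one; 2. for every $t\ge 0$, $Y^{(\times)_\tau}_t=M_1(\Omega'\times[0,t])$ $\mathbf P$-almost surely; 3. $(Y^{(\times)_\tau}_t)_{t\ge 0}$ is, up to modification, a standard Brownian motion. Thus, by time-changing the kernel, a Brownian motion is extracted from the fractional Brownian motion $Y^{(\times)}$ with Hurst exponent less than $1/2$. -/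

import Mathlib

open MeasureTheory ProbabilityTheory Filter Topology Set
open scoped NNReal ENNReal

noncomputable section

/-- `X` is a fractional Brownian motion (time axis `[0, ∞)`) with Hurst exponent `H ∈ (0, 1)` and
variance `v > 0` at time one: a centered Gaussian process with covariance
`(v / 2) * (s ^ (2 H) + t ^ (2 H) - |s - t| ^ (2 H))` and almost surely continuous paths. -/
structure IsFractionalBrownian {Ω : Type*} [MeasurableSpace Ω]
    (X : ℝ≥0 → Ω → ℝ) (H v : ℝ) (P : Measure Ω) : Prop where
  hurst_pos : 0 < H
  hurst_lt_one : H < 1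
  var_pos : 0 < v
  isGaussianProcess : IsGaussianProcess X P
  mean_zero : ∀ t, ∫ ω, X t ω ∂P = 0
  covariance_eq : ∀ s t : ℝ≥0, cov[X s, X t; P] =
    v / 2 * ((s : ℝ) ^ (2 * H) + (t : ℝ) ^ (2 * H) - |(s : ℝ) - (t : ℝ)| ^ (2 * H))
  continuous_paths : ∀ᵐ ω ∂P, Continuous fun t ↦ X t ω

/-- `M` is a Gaussian random measure on `E` with control measure `m`, defined on the probability
space `(Ω, P)`: on measurable sets of finite `m`-measure, `M A` has law `N(0, m A)`, the values on
disjoint sets are independent, and `M` is almost surely σ-additive. The values of `M` on other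
sets are irrelevant. (The series in `sigmaAdditive` need not converge absolutely, hence the
convergence of the partial sums.) -/
structure IsGaussianRandomMeasure {E Ω : Type*} [MeasurableSpace E] [MeasurableSpace Ω]
    (M : Set E → Ω → ℝ) (m : Measure E) (P : Measure Ω) : Prop where
  hasLaw : ∀ A, MeasurableSet A → m A < ∞ →
    HasLaw (M A) (gaussianReal 0 (m A).toNNReal) P
  indep : ∀ (n : ℕ) (A : Fin n → Set E), (∀ i, MeasurableSet (A i)) → (∀ i, m (A i) < ∞) →
    (∀ i j, i ≠ j → Disjoint (A i) (A j)) → iIndepFun (fun i ↦ M (A i)) P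
  sigmaAdditive : ∀ A : ℕ → Set E, (∀ i, MeasurableSet (A i)) → m (⋃ i, A i) < ∞ →
    (∀ i j, i ≠ j → Disjoint (A i) (A j)) →
    ∀ᵐ ω ∂P, Tendsto (fun n ↦ ∑ i ∈ Finset.range n, M (A i) ω) atTop (𝓝 (M (⋃ i, A i) ω))

/-- The elementary function `∑ a_A 1_A` given by a finite family of coefficients `a_A`. -/
def elementaryFun {E : Type*} (a : Set E →₀ ℝ) (x : E) : ℝ :=
  a.sum fun A r ↦ r * A.indicator (fun _ ↦ (1 : ℝ)) x

/-- The integral `∑ a_A M(A)` of the elementary function `∑ a_A 1_A`. -/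
def elementaryIntegral {E Ω : Type*} (M : Set E → Ω → ℝ) (a : Set E →₀ ℝ) (ω : Ω) : ℝ :=
  a.sum fun A r ↦ r * M A ω

/-- `X` is (a version of) the stochastic integral `∫ f dM` of `f ∈ L²(m)`: it is the limit in
`L²(P)` of integrals of elementary functions which converge to `f` in `L²(m)`. -/
def IsStochasticIntegral {E Ω : Type*} [MeasurableSpace E] [MeasurableSpace Ω]
    (M : Set E → Ω → ℝ) (m : Measure E) (P : Measure Ω) (f : E → ℝ) (X : Ω → ℝ) : Prop :=
  MemLp f 2 m ∧ MemLp X 2 P ∧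
    ∃ a : ℕ → (Set E →₀ ℝ),
      (∀ n, ∀ A ∈ (a n).support, MeasurableSet A ∧ m A < ∞) ∧
      Tendsto (fun n ↦ eLpNorm (fun x ↦ elementaryFun (a n) x - f x) 2 m) atTop (𝓝 0) ∧
      Tendsto (fun n ↦ eLpNorm (fun ω ↦ elementaryIntegral M (a n) ω - X ω) 2 P) atTop (𝓝 0)

open Classical in
/-- The stochastic integral `∫ f dM`, a random variable determined up to `P`-null sets
(`0` by convention if the integral does not exist). -/
def stochasticIntegral {E Ω : Type*} [MeasurableSpace E] [MeasurableSpace Ω]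
    (M : Set E → Ω → ℝ) (m : Measure E) (P : Measure Ω) (f : E → ℝ) : Ω → ℝ :=
  if h : ∃ X, IsStochasticIntegral M m P f X then h.choose else 0

/-- The kernel `(ω', x) ↦ 1_{[0, Z(ω')]}(x)`, where `[0, y]` is the interval between `0` and `y`
whatever the sign of `y`. -/
def indicatorKernel {Ω' : Type*} (Z : Ω' → ℝ) (p : Ω' × ℝ) : ℝ :=
  (uIcc 0 (Z p.1)).indicator (fun _ ↦ (1 : ℝ)) p.2

/-- The first time `τ_s = inf {t ≥ 0 : Y_t = s}` at which `Y` hits the level `s`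
(`⊤` if there is no such time). -/
def levelHittingTime {Ω' : Type*} (Y : ℝ≥0 → Ω' → ℝ) (s : ℝ≥0) : Ω' → WithTop ℝ≥0 :=
  hittingAfter Y {(s : ℝ)} 0

/-- The indicator fractional motion `Y^(×)_t = ∫ 1_{[0, Y_t(ω')]}(x) M(dω' × dx)`. -/
def indicatorMotion {Ω Ω' : Type*} [MeasurableSpace Ω] [MeasurableSpace Ω']
    (M : Set (Ω' × ℝ) → Ω → ℝ) (P : Measure Ω) (P' : Measure Ω')
    (Y : ℝ≥0 → Ω' → ℝ) (t : ℝ≥0) : Ω → ℝ :=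
  stochasticIntegral M (P'.prod volume) P (indicatorKernel (Y t))

/-- The process with time-changed kernel, `∫ 1_{[0, Y_{τ_t}(ω')]}(x) M(dω' × dx)`. -/
def timeChangedIndicatorMotion {Ω Ω' : Type*} [MeasurableSpace Ω] [MeasurableSpace Ω']
    (M : Set (Ω' × ℝ) → Ω → ℝ) (P : Measure Ω) (P' : Measure Ω')
    (Y : ℝ≥0 → Ω' → ℝ) (t : ℝ≥0) : Ω → ℝ :=
  stochasticIntegral M (P'.prod volume) P
    (indicatorKernel (stoppedValue Y (levelHittingTime Y t)))

end

/-! The integral of an indicator `1_A` is `M A`, so each process consists of the values of `M` on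
the regions between the axis and the graph of a random variable `Z t`. Such values are jointly
Gaussian with covariance the control measure of the intersection. Since `[0, a] ∩ [0, b]` has length
`(|a| + |b| - |a - b|) / 2`, this covariance is `(E'|Z s| + E'|Z t| - E'|Z s - Z t|) / 2`.

For `Z = Y`, Gaussian scaling gives `E'|Y s - Y t| = E'|Y 1| * |s - t| ^ H`: passing from second to
first absolute moments halves the exponent, whence the Hurst exponent `H / 2`. For the time-changed
kernel, path continuity gives `Y_{τ_t} = t` almost surely, so the region is `Ω' × [0, t]` up to a
null set and the covariance is `min s t`. Continuous modifications come from Kolmogorov–Chentsov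
(`exists_continuous_modification`).

The remaining point is that every level is hit. The normalized values of `Y` at the times `T * 2 ^
i` have geometrically decaying correlations. A second moment argument
(`IsGaussianProcess.ae_exists_lt`) shows that one of them exceeds `1 / 10`; for `T` large this
carries `Y` above any level, and the intermediate value theorem concludes. -/

lemma covariance_congr_ae {Ω : Type*} [MeasurableSpace Ω] {P : Measure Ω} {X X' Y Y' : Ω → ℝ}
    (hX : X =ᵐ[P] X') (hY : Y =ᵐ[P] Y') : cov[X, Y; P] = cov[X', Y'; P] := by
  simp only [covariance, integral_congr_ae hX, integral_congr_ae hY]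
  refine integral_congr_ae ?_
  filter_upwards [hX, hY] with ω h h'
  rw [h, h']

/-! ### Gaussian random measures: finite additivity, joint Gaussianity, covariance. -/

namespace IsGaussianRandomMeasure

variable {E Ω : Type*} [MeasurableSpace E] [MeasurableSpace Ω]
  {M : Set E → Ω → ℝ} {m : Measure E} {P : Measure Ω}

lemma hasGaussianLaw (hM : IsGaussianRandomMeasure M m P) {A : Set E} (hA : MeasurableSet A)
    (hmA : m A < ∞) : HasGaussianLaw (M A) P :=
  (hM.hasLaw A hA hmA).hasGaussianLaw

lemma memLp_two (hM : IsGaussianRandomMeasure M m P) {A : Set E} (hA : MeasurableSet A)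
    (hmA : m A < ∞) : MemLp (M A) 2 P :=
  (hM.hasGaussianLaw hA hmA).memLp_two

lemma integral_eq_zero (hM : IsGaussianRandomMeasure M m P) {A : Set E} (hA : MeasurableSet A)
    (hmA : m A < ∞) : ∫ ω, M A ω ∂P = 0 := by
  rw [(hM.hasLaw A hA hmA).integral_eq, integral_id_gaussianReal]

lemma empty_ae_eq_zero (hM : IsGaussianRandomMeasure M m P) : ∀ᵐ ω ∂P, M ∅ ω = 0 := by
  have h := hM.hasLaw ∅ .empty (by simp)
  simp only [measure_empty, ENNReal.toNNReal_zero, gaussianReal_zero_var] at h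
  exact h.ae_eq_of_dirac

lemma union_ae_eq (hM : IsGaussianRandomMeasure M m P) {A B : Set E} (hA : MeasurableSet A)
    (hB : MeasurableSet B) (hmA : m A < ∞) (hmB : m B < ∞) (hAB : Disjoint A B) :
    ∀ᵐ ω ∂P, M (A ∪ B) ω = M A ω + M B ω := by
  -- Additivity is assumed only along sequences, so the pair is padded with empty sets; `M ∅`
  -- vanishes almost surely because its law is `N(0, 0)`.
  let S : ℕ → Set E := fun n ↦ if n = 0 then A else if n = 1 then B else ∅
  have hS : ⋃ i, S i = A ∪ B := by
    ext x
    simp only [mem_iUnion, mem_union]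
    constructor
    · rintro ⟨i, hi⟩
      by_cases h0 : i = 0
      · simp_all [S]
      by_cases h1 : i = 1 <;> simp_all [S]
    · rintro (h | h)
      · exact ⟨0, by simpa [S]⟩
      · exact ⟨1, by simpa [S]⟩
  have h := hM.sigmaAdditive S (fun i ↦ by simp only [S]; split_ifs <;> simp [hA, hB])
    (by rw [hS]; exact measure_union_lt_top hmA hmB) (fun i j hij ↦ by
      simp only [S]; split_ifs <;> simp_all [hAB.symm])
  filter_upwards [h, hM.empty_ae_eq_zero] with ω h h0
  rw [hS] at h
  refine tendsto_nhds_unique h (tendsto_atTop_of_eventually_const (i₀ := 2) fun n hn ↦ ?_)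
  obtain ⟨k, rfl⟩ := Nat.exists_eq_add_of_le' hn
  rw [Finset.sum_range_succ', Finset.sum_range_succ']
  simp [S, h0, add_comm]

lemma biUnion_ae_eq (hM : IsGaussianRandomMeasure M m P) {ι : Type*} (s : Finset ι)
    {A : ι → Set E} (hA : ∀ i ∈ s, MeasurableSet (A i)) (hmA : ∀ i ∈ s, m (A i) < ∞)
    (hd : (s : Set ι).PairwiseDisjoint A) :
    ∀ᵐ ω ∂P, M (⋃ i ∈ s, A i) ω = ∑ i ∈ s, M (A i) ω := by
  classical
  induction s using Finset.induction_on with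
  | empty => simpa using hM.empty_ae_eq_zero
  | insert a s ha ih =>
    have h1 := ih (fun i hi ↦ hA i (Finset.mem_insert_of_mem hi))
      (fun i hi ↦ hmA i (Finset.mem_insert_of_mem hi)) (hd.subset (by simp))
    have hdis : Disjoint (A a) (⋃ i ∈ s, A i) := by
      rw [disjoint_iUnion₂_right]
      exact fun i hi ↦ hd (by simp) (by simp [hi]) (by rintro rfl; exact ha hi)
    have h2 := hM.union_ae_eq (hA a (by simp))
      (s.measurableSet_biUnion fun i hi ↦ hA i (Finset.mem_insert_of_mem hi)) (hmA a (by simp))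
      (measure_biUnion_lt_top s.finite_toSet
        fun i hi ↦ hmA i (Finset.mem_insert_of_mem hi)) hdis
    filter_upwards [h1, h2] with ω h1 h2
    rw [Finset.set_biUnion_insert, h2, h1, Finset.sum_insert ha]

lemma iIndepFun_of_pairwise_disjoint (hM : IsGaussianRandomMeasure M m P) {ι : Type*} [Fintype ι]
    {A : ι → Set E} (hA : ∀ i, MeasurableSet (A i)) (hmA : ∀ i, m (A i) < ∞)
    (hd : Pairwise fun i j ↦ Disjoint (A i) (A j)) : iIndepFun (fun i ↦ M (A i)) P := by
  let e := Fintype.equivFin ι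
  have h := hM.indep _ (fun k ↦ A (e.symm k)) (fun k ↦ hA _) (fun k ↦ hmA _)
    (fun i j hij ↦ hd (by simpa using hij))
  simpa using h.precomp e.injective

lemma indepFun_of_disjoint (hM : IsGaussianRandomMeasure M m P) {A B : Set E}
    (hA : MeasurableSet A) (hB : MeasurableSet B) (hmA : m A < ∞) (hmB : m B < ∞)
    (hAB : Disjoint A B) : IndepFun (M A) (M B) P := by
  have h := hM.indep 2 ![A, B] (by simp [Fin.forall_fin_two, hA, hB])
    (by simp [Fin.forall_fin_two, hmA, hmB]) (by simp [Fin.forall_fin_two, hAB, hAB.symm])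
  simpa using h.indepFun (i := 0) (j := 1) (by simp)

/-- The values of a Gaussian random measure on finitely many sets are jointly Gaussian. -/
lemma hasGaussianLaw_pi (hM : IsGaussianRandomMeasure M m P) {ι : Type*} [Fintype ι]
    {A : ι → Set E} (hA : ∀ i, MeasurableSet (A i)) (hmA : ∀ i, m (A i) < ∞) :
    HasGaussianLaw (fun ω i ↦ M (A i) ω) P := by
  classical
  -- The atoms of the algebra generated by the `A i`: `T S` holds the points lying in `A i` exactly
  -- for `i ∈ S`. Excluding `S = ∅` keeps them of finite measure. Their values are independent
  -- Gaussians, and each `M (A i)` is a sum of some of them.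
  let κ := {S : Finset ι // S.Nonempty}
  let T : κ → Set E := fun S ↦ {x | ∀ i, x ∈ A i ↔ i ∈ S.1}
  have hT : ∀ S, MeasurableSet (T S) := fun S ↦ by
    have : T S = ⋂ i, {x | x ∈ A i ↔ i ∈ S.1} := by ext; simp [T]
    rw [this]
    exact MeasurableSet.iInter fun i ↦ (hA i).iff (.const _)
  have hmT : ∀ S, m (T S) < ∞ := fun S ↦ by
    obtain ⟨i, hi⟩ := S.2
    exact (measure_mono fun x hx ↦ (hx i).2 hi).trans_lt (hmA i)
  have hd : Pairwise fun S S' ↦ Disjoint (T S) (T S') := fun S S' hne ↦ by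
    refine Set.disjoint_left.2 fun x hx hx' ↦ ?_
    exact hne (Subtype.ext (Finset.ext fun i ↦ (hx i).symm.trans (hx' i)))
  have hG := (hM.iIndepFun_of_pairwise_disjoint hT hmT hd).hasGaussianLaw
    (fun S ↦ hM.hasGaussianLaw (hT S) (hmT S))
  let L : (κ → ℝ) →L[ℝ] (ι → ℝ) := ContinuousLinearMap.pi fun i ↦
    ∑ S ∈ Finset.univ.filter (fun S : κ ↦ i ∈ S.1), ContinuousLinearMap.proj S
  refine (hG.map L).congr ?_
  have hdecomp : ∀ i, A i = ⋃ S ∈ Finset.univ.filter (fun S : κ ↦ i ∈ S.1), T S := fun i ↦ by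
    ext x
    simp only [Finset.mem_filter, Finset.mem_univ, true_and, mem_iUnion, exists_prop]
    constructor
    · intro hx
      exact ⟨⟨Finset.univ.filter fun j ↦ x ∈ A j, i, by simpa⟩, by simpa, fun j ↦ by simp⟩
    · rintro ⟨S, hi, hx⟩
      exact (hx i).2 hi
  have hae : ∀ᵐ ω ∂P, ∀ i, M (A i) ω =
      ∑ S ∈ Finset.univ.filter (fun S : κ ↦ i ∈ S.1), M (T S) ω := by
    rw [ae_all_iff]
    intro i
    have := hM.biUnion_ae_eq (Finset.univ.filter (fun S : κ ↦ i ∈ S.1)) (A := T)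
      (fun S _ ↦ hT S) (fun S _ ↦ hmT S) (hd.set_pairwise _)
    rwa [← hdecomp i] at this
  filter_upwards [hae] with ω hω
  ext i
  simp [L, hω]

lemma isGaussianProcess (hM : IsGaussianRandomMeasure M m P) {T : Type*} {A : T → Set E}
    (hA : ∀ i, MeasurableSet (A i)) (hmA : ∀ i, m (A i) < ∞) :
    IsGaussianProcess (fun t ↦ M (A t)) P where
  hasGaussianLaw I := hM.hasGaussianLaw_pi (A := fun i : I ↦ A i) (fun i ↦ hA i) (fun i ↦ hmA i)

/-- Split both sets along `A ∩ B`. The three pieces are disjoint, hence independent, and only the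
variance of `M (A ∩ B)` survives. -/
lemma covariance_eq (hM : IsGaussianRandomMeasure M m P) [IsProbabilityMeasure P] {A B : Set E}
    (hA : MeasurableSet A) (hB : MeasurableSet B) (hmA : m A < ∞) (hmB : m B < ∞) :
    cov[M A, M B; P] = m.real (A ∩ B) := by
  have hI := hA.inter hB
  have hmI : m (A ∩ B) < ∞ := (measure_mono inter_subset_left).trans_lt hmA
  have hAB := hA.diff hB
  have hBA := hB.diff hA
  have hmAB : m (A \ B) < ∞ := (measure_mono sdiff_subset).trans_lt hmA
  have hmBA : m (B \ A) < ∞ := (measure_mono sdiff_subset).trans_lt hmB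
  have d1 : Disjoint (A ∩ B) (A \ B) := disjoint_sdiff_inter.symm
  have d2 : Disjoint (A ∩ B) (B \ A) := by rw [inter_comm]; exact disjoint_sdiff_inter.symm
  have d3 : Disjoint (A \ B) (B \ A) := disjoint_sdiff_sdiff
  have e1 : M A =ᵐ[P] M (A ∩ B) + M (A \ B) := by
    have := hM.union_ae_eq hI hAB hmI hmAB d1
    rwa [inter_union_sdiff] at this
  have e2 : M B =ᵐ[P] M (A ∩ B) + M (B \ A) := by
    have := hM.union_ae_eq hI hBA hmI hmBA d2
    rwa [inter_comm, inter_union_sdiff, inter_comm B] at this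
  rw [covariance_congr_ae e1 e2, covariance_add_left, covariance_add_right, covariance_add_right,
    (hM.indepFun_of_disjoint hI hBA hmI hmBA d2).covariance_eq_zero,
    (hM.indepFun_of_disjoint hAB hI hmAB hmI d1.symm).covariance_eq_zero,
    (hM.indepFun_of_disjoint hAB hBA hmAB hmBA d3).covariance_eq_zero, covariance_self,
    (hM.hasLaw _ hI hmI).variance_eq, variance_id_gaussianReal]
  · simp [Measure.real, ENNReal.toReal]
  · exact (hM.hasLaw _ hI hmI).aemeasurable
  any_goals first
    | exact hM.memLp_two hI hmI
    | exact hM.memLp_two hAB hmAB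
    | exact hM.memLp_two hBA hmBA
    | exact (hM.memLp_two hI hmI).add (hM.memLp_two hBA hmBA)

lemma integral_mul_eq (hM : IsGaussianRandomMeasure M m P) [IsProbabilityMeasure P] {A B : Set E}
    (hA : MeasurableSet A) (hB : MeasurableSet B) (hmA : m A < ∞) (hmB : m B < ∞) :
    ∫ ω, M A ω * M B ω ∂P = m.real (A ∩ B) := by
  have h := covariance_eq_sub (hM.memLp_two hA hmA) (hM.memLp_two hB hmB)
  rw [hM.covariance_eq hA hB hmA hmB, hM.integral_eq_zero hA hmA] at h
  simpa using h.symm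

lemma memLp_elementaryIntegral (hM : IsGaussianRandomMeasure M m P) {a : Set E →₀ ℝ}
    (ha : ∀ A ∈ a.support, MeasurableSet A ∧ m A < ∞) : MemLp (elementaryIntegral M a) 2 P :=
  memLp_finsetSum _ fun A hA ↦ (hM.memLp_two (ha A hA).1 (ha A hA).2).const_mul _

end IsGaussianRandomMeasure

/-! ### The stochastic integral: isometry, uniqueness, indicators. -/

section StochasticIntegral

variable {E Ω : Type*} [MeasurableSpace E] [MeasurableSpace Ω]
  {M : Set E → Ω → ℝ} {m : Measure E} {P : Measure Ω}

lemma memLp_elementaryFun {a : Set E →₀ ℝ}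
    (ha : ∀ A ∈ a.support, MeasurableSet A ∧ m A < ∞) : MemLp (elementaryFun a) 2 m :=
  memLp_finsetSum _ fun A hA ↦
    (memLp_indicator_const 2 (ha A hA).1 1 (Or.inr (ha A hA).2.ne)).const_mul _

omit [MeasurableSpace E] in
lemma elementaryFun_sub (a b : Set E →₀ ℝ) (x : E) :
    elementaryFun (a - b) x = elementaryFun a x - elementaryFun b x :=
  Finsupp.sum_sub_index fun _ _ _ ↦ sub_mul _ _ _

omit [MeasurableSpace E] [MeasurableSpace Ω] in
lemma elementaryIntegral_sub (a b : Set E →₀ ℝ) (ω : Ω) :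
    elementaryIntegral M (a - b) ω = elementaryIntegral M a ω - elementaryIntegral M b ω :=
  Finsupp.sum_sub_index fun _ _ _ ↦ sub_mul _ _ _

/-- Expanding the square gives a quadratic form in the measures of intersections, the same one that
`M` produces below; the isometry follows without making the sets disjoint. -/
lemma integral_elementaryFun_sq {a : Set E →₀ ℝ}
    (ha : ∀ A ∈ a.support, MeasurableSet A ∧ m A < ∞) :
    ∫ x, elementaryFun a x ^ 2 ∂m =
      ∑ A ∈ a.support, ∑ B ∈ a.support, a A * a B * m.real (A ∩ B) := by
  have key : ∀ x, elementaryFun a x ^ 2 = ∑ A ∈ a.support, ∑ B ∈ a.support,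
      a A * a B * (A ∩ B).indicator (fun _ ↦ (1 : ℝ)) x := fun x ↦ by
    rw [elementaryFun, Finsupp.sum, sq, Finset.sum_mul_sum]
    refine Finset.sum_congr rfl fun A _ ↦ Finset.sum_congr rfl fun B _ ↦ ?_
    by_cases hA : x ∈ A <;> by_cases hB : x ∈ B <;> simp [hA, hB]
  have hint : ∀ A ∈ a.support, ∀ B ∈ a.support, Integrable
      (fun x ↦ a A * a B * (A ∩ B).indicator (fun _ ↦ (1 : ℝ)) x) m := fun A hA B hB ↦
    ((integrable_indicator_iff ((ha A hA).1.inter (ha B hB).1)).2 (integrableOn_const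
      ((measure_mono inter_subset_left).trans_lt (ha A hA).2).ne)).const_mul _
  simp_rw [key]
  rw [integral_finsetSum _ fun A hA ↦ integrable_finsetSum _ fun B hB ↦ hint A hA B hB]
  refine Finset.sum_congr rfl fun A hA ↦ ?_
  rw [integral_finsetSum _ fun B hB ↦ hint A hA B hB]
  refine Finset.sum_congr rfl fun B hB ↦ ?_
  rw [integral_const_mul, integral_indicator_const _ ((ha A hA).1.inter (ha B hB).1)]
  simp

lemma IsGaussianRandomMeasure.integral_elementaryIntegral_sq (hM : IsGaussianRandomMeasure M m P)
    [IsProbabilityMeasure P] {a : Set E →₀ ℝ}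
    (ha : ∀ A ∈ a.support, MeasurableSet A ∧ m A < ∞) :
    ∫ ω, elementaryIntegral M a ω ^ 2 ∂P =
      ∑ A ∈ a.support, ∑ B ∈ a.support, a A * a B * m.real (A ∩ B) := by
  have key : ∀ ω, elementaryIntegral M a ω ^ 2 = ∑ A ∈ a.support, ∑ B ∈ a.support,
      a A * a B * (M A ω * M B ω) := fun x ↦ by
    rw [elementaryIntegral, Finsupp.sum, sq, Finset.sum_mul_sum]
    exact Finset.sum_congr rfl fun A _ ↦ Finset.sum_congr rfl fun B _ ↦ by ring
  have hint : ∀ A ∈ a.support, ∀ B ∈ a.support, Integrable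
      (fun ω ↦ a A * a B * (M A ω * M B ω)) P := fun A hA B hB ↦
    ((hM.memLp_two (ha A hA).1 (ha A hA).2).integrable_mul
      (hM.memLp_two (ha B hB).1 (ha B hB).2)).const_mul _
  simp_rw [key]
  rw [integral_finsetSum _ fun A hA ↦ integrable_finsetSum _ fun B hB ↦ hint A hA B hB]
  refine Finset.sum_congr rfl fun A hA ↦ ?_
  rw [integral_finsetSum _ fun B hB ↦ hint A hA B hB]
  refine Finset.sum_congr rfl fun B hB ↦ ?_
  rw [integral_const_mul, hM.integral_mul_eq (ha A hA).1 (ha B hB).1 (ha A hA).2 (ha B hB).2]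

/-- The Itô-type isometry on elementary functions. -/
lemma IsGaussianRandomMeasure.eLpNorm_elementaryIntegral (hM : IsGaussianRandomMeasure M m P)
    [IsProbabilityMeasure P] {a : Set E →₀ ℝ}
    (ha : ∀ A ∈ a.support, MeasurableSet A ∧ m A < ∞) :
    eLpNorm (elementaryIntegral M a) 2 P = eLpNorm (elementaryFun a) 2 m := by
  rw [(hM.memLp_elementaryIntegral ha).eLpNorm_eq_integral_rpow_norm (by simp) (by simp),
    (memLp_elementaryFun ha).eLpNorm_eq_integral_rpow_norm (by simp) (by simp)]
  simp only [ENNReal.toReal_ofNat, Real.norm_eq_abs, Real.rpow_ofNat, sq_abs]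
  rw [hM.integral_elementaryIntegral_sq ha, integral_elementaryFun_sq ha]

/-- The stochastic integral is unique up to null sets. -/
lemma IsStochasticIntegral.ae_eq (hM : IsGaussianRandomMeasure M m P)
    [IsProbabilityMeasure P] {f : E → ℝ} {X X' : Ω → ℝ} (h : IsStochasticIntegral M m P f X)
    (h' : IsStochasticIntegral M m P f X') : X =ᵐ[P] X' := by
  obtain ⟨hf, hX, a, ha, haf, haX⟩ := h
  obtain ⟨-, hX', b, hb, hbf, hbX⟩ := h'
  have hab : ∀ n, ∀ A ∈ (a n - b n).support, MeasurableSet A ∧ m A < ∞ := fun n A hA ↦ by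
    classical
    rcases Finset.mem_union.1 (Finsupp.support_sub hA) with h | h
    exacts [ha n A h, hb n A h]
  -- The two approximations are compared through the integral of `a n - b n`, which the isometry
  -- moves to `L²(m)`, where both approximate `f`.
  have hle : ∀ n, eLpNorm (X - X') 2 P ≤
      eLpNorm (fun ω ↦ elementaryIntegral M (a n) ω - X ω) 2 P
      + (eLpNorm (fun x ↦ elementaryFun (a n) x - f x) 2 m
        + eLpNorm (fun x ↦ elementaryFun (b n) x - f x) 2 m)
      + eLpNorm (fun ω ↦ elementaryIntegral M (b n) ω - X' ω) 2 P := fun n ↦ by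
    have hIa := hM.memLp_elementaryIntegral (ha n)
    have hIb := hM.memLp_elementaryIntegral (hb n)
    have e1 : X - X' = -(fun ω ↦ elementaryIntegral M (a n) ω - X ω)
        + elementaryIntegral M (a n - b n)
        + (fun ω ↦ elementaryIntegral M (b n) ω - X' ω) := by
      ext ω
      simp only [Pi.sub_apply, Pi.add_apply, Pi.neg_apply, elementaryIntegral_sub]
      ring
    have e2 : elementaryFun (a n - b n) = (fun x ↦ elementaryFun (a n) x - f x)
        - (fun x ↦ elementaryFun (b n) x - f x) := by
      ext x
      simp only [Pi.sub_apply, elementaryFun_sub]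
      ring
    have m1 := (hIa.sub hX).aestronglyMeasurable
    have m2 := (hM.memLp_elementaryIntegral (hab n)).aestronglyMeasurable
    have m3 := (hIb.sub hX').aestronglyMeasurable
    rw [e1]
    refine (eLpNorm_add_le (m1.neg.add m2) m3 (by simp)).trans (add_le_add ?_ le_rfl)
    refine (eLpNorm_add_le m1.neg m2 (by simp)).trans ?_
    rw [eLpNorm_neg, hM.eLpNorm_elementaryIntegral (hab n), e2]
    exact add_le_add le_rfl <| eLpNorm_sub_le
      ((memLp_elementaryFun (ha n)).sub hf).aestronglyMeasurable
      ((memLp_elementaryFun (hb n)).sub hf).aestronglyMeasurable one_le_two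
  have hlim := ge_of_tendsto' ((haX.add (haf.add hbf)).add hbX) hle
  simp only [add_zero, nonpos_iff_eq_zero] at hlim
  rw [eLpNorm_eq_zero_iff (hX.sub hX').aestronglyMeasurable (by simp)] at hlim
  filter_upwards [hlim] with ω hω
  simpa [sub_eq_zero] using hω

/-- A constant approximating sequence suffices. Equality is only asked almost everywhere because the
kernels are indicators of measurable sets only up to null sets. -/
lemma IsGaussianRandomMeasure.isStochasticIntegral_of_ae_eq_indicator
    (hM : IsGaussianRandomMeasure M m P) {f : E → ℝ} {A : Set E} (hA : MeasurableSet A)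
    (hmA : m A < ∞) (hf : f =ᵐ[m] A.indicator fun _ ↦ 1) :
    IsStochasticIntegral M m P f (M A) := by
  refine ⟨(memLp_congr_ae hf).2 (memLp_indicator_const 2 hA 1 (Or.inr hmA.ne)),
    hM.memLp_two hA hmA, fun _ ↦ Finsupp.single A 1, fun n B hB ↦ ?_, ?_, ?_⟩
  · obtain rfl : B = A := by simpa using Finsupp.support_single_subset hB
    exact ⟨hA, hmA⟩
  · have : (fun x ↦ elementaryFun (Finsupp.single A 1) x - f x) =ᵐ[m] 0 := by
      filter_upwards [hf] with x hx
      simp [elementaryFun, hx]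
    simp [eLpNorm_congr_ae this]
  · simp [elementaryIntegral]

lemma isStochasticIntegral_stochasticIntegral {f : E → ℝ} {X : Ω → ℝ}
    (h : IsStochasticIntegral M m P f X) :
    IsStochasticIntegral M m P f (stochasticIntegral M m P f) := by
  have h' : ∃ X, IsStochasticIntegral M m P f X := ⟨X, h⟩
  rw [stochasticIntegral, dif_pos h']
  exact h'.choose_spec

end StochasticIntegral

/-! ### Dyadic approximation of functions on the half-line. -/

section Dyadic

/-- The largest point `k / 2 ^ n` that is at most `t`. -/
noncomputable def dyadicFloor (n : ℕ) (t : ℝ≥0) : ℝ≥0 := ⌊2 ^ n * t⌋₊ / 2 ^ n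

lemma dyadicFloor_le (n : ℕ) (t : ℝ≥0) : dyadicFloor n t ≤ t := by
  rw [dyadicFloor, div_le_iff₀ (by positivity), mul_comm t]
  exact Nat.floor_le (by positivity)

lemma lt_dyadicFloor_add (n : ℕ) (t : ℝ≥0) : t < dyadicFloor n t + 1 / 2 ^ n := by
  rw [dyadicFloor, ← add_div, lt_div_iff₀ (by positivity), mul_comm t]
  exact Nat.lt_floor_add_one _

lemma abs_dyadicFloor_sub_le (n : ℕ) (t : ℝ≥0) : |(dyadicFloor n t : ℝ) - t| ≤ 1 / 2 ^ n := by
  have h1 : (dyadicFloor n t : ℝ) ≤ t := dyadicFloor_le n t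
  have h2 : (t : ℝ) < dyadicFloor n t + 1 / 2 ^ n := by exact_mod_cast lt_dyadicFloor_add n t
  rw [abs_le]
  constructor <;> linarith [show (0 : ℝ) ≤ 1 / 2 ^ n by positivity]

/-- Consequently one refinement moves the dyadic approximation by at most one cell of the finer
grid. -/
lemma floor_two_pow_succ (n : ℕ) (t : ℝ≥0) :
    ⌊2 ^ (n + 1) * t⌋₊ = 2 * ⌊2 ^ n * t⌋₊ ∨ ⌊2 ^ (n + 1) * t⌋₊ = 2 * ⌊2 ^ n * t⌋₊ + 1 := by
  have h1 : 2 * ⌊2 ^ n * t⌋₊ ≤ ⌊2 ^ (n + 1) * t⌋₊ := by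
    refine Nat.le_floor ?_
    have := Nat.floor_le (a := 2 ^ n * t) (by positivity)
    push_cast
    rw [pow_succ', mul_assoc]
    gcongr
  have h2 : ⌊2 ^ (n + 1) * t⌋₊ < 2 * ⌊2 ^ n * t⌋₊ + 2 := by
    rw [Nat.floor_lt (by positivity)]
    have := Nat.lt_floor_add_one (2 ^ n * t)
    push_cast
    calc 2 ^ (n + 1) * t = 2 * (2 ^ n * t) := by ring
      _ < 2 * (⌊2 ^ n * t⌋₊ + 1) := by gcongr
      _ = _ := by ring
  omega

lemma floor_le_floor_add_one {n : ℕ} {s t : ℝ≥0} (h : t ≤ s + 1 / 2 ^ n) :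
    ⌊2 ^ n * t⌋₊ ≤ ⌊2 ^ n * s⌋₊ + 1 := by
  rw [← Nat.floor_add_one (by positivity)]
  refine Nat.floor_le_floor ?_
  calc 2 ^ n * t ≤ 2 ^ n * (s + 1 / 2 ^ n) := by gcongr
    _ = _ := by field_simp

variable {x : ℝ≥0 → ℝ} {N : ℕ} {S r : ℝ}

lemma abs_dyadicFloor_succ_sub_le (hS : 0 ≤ S) (hr : 0 ≤ r)
    (hx : ∀ n k : ℕ, k < N * 2 ^ n → |x ((k + 1 : ℕ) / 2 ^ n) - x (k / 2 ^ n)| ≤ S * r ^ n)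
    {t : ℝ≥0} (ht : t < N) (n : ℕ) :
    |x (dyadicFloor (n + 1) t) - x (dyadicFloor n t)| ≤ S * r ^ (n + 1) := by
  have e : (⌊2 ^ n * t⌋₊ : ℝ≥0) / 2 ^ n = (2 * ⌊2 ^ n * t⌋₊ : ℕ) / 2 ^ (n + 1) := by
    push_cast
    field_simp
    ring
  rcases floor_two_pow_succ n t with h | h
  · rw [dyadicFloor, dyadicFloor, h, e, sub_self, abs_zero]
    positivity
  · rw [dyadicFloor, dyadicFloor, h, e]
    refine hx (n + 1) _ ?_
    have h1 : ⌊2 ^ (n + 1) * t⌋₊ < N * 2 ^ (n + 1) := by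
      rw [Nat.floor_lt (by positivity)]
      push_cast
      rw [mul_comm (N : ℝ≥0)]
      gcongr
    omega

lemma abs_dyadicFloor_sub_dyadicFloor_le (hS : 0 ≤ S) (hr : 0 ≤ r)
    (hx : ∀ n k : ℕ, k < N * 2 ^ n → |x ((k + 1 : ℕ) / 2 ^ n) - x (k / 2 ^ n)| ≤ S * r ^ n)
    {s t : ℝ≥0} (hst : s ≤ t) (ht : t < N) {n : ℕ} (h : t ≤ s + 1 / 2 ^ n) :
    |x (dyadicFloor n t) - x (dyadicFloor n s)| ≤ S * r ^ n := by
  have h1 := floor_le_floor_add_one h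
  have h2 : ⌊2 ^ n * s⌋₊ ≤ ⌊2 ^ n * t⌋₊ := Nat.floor_le_floor (by gcongr)
  rcases (by omega : ⌊2 ^ n * t⌋₊ = ⌊2 ^ n * s⌋₊ ∨ ⌊2 ^ n * t⌋₊ = ⌊2 ^ n * s⌋₊ + 1) with h | h
  · rw [dyadicFloor, dyadicFloor, h, sub_self, abs_zero]
    positivity
  · rw [dyadicFloor, dyadicFloor, h]
    refine hx n _ ?_
    have h1 : ⌊2 ^ n * t⌋₊ < N * 2 ^ n := by
      rw [Nat.floor_lt (by positivity)]
      push_cast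
      rw [mul_comm (N : ℝ≥0)]
      gcongr
    omega

/-- If the dyadic increments of `x` decay geometrically, then `x` converges along dyadic
approximations. -/
lemma exists_tendsto_dyadicFloor (hS : 0 ≤ S) (hr : 0 ≤ r) (hr1 : r < 1)
    (hx : ∀ n k : ℕ, k < N * 2 ^ n → |x ((k + 1 : ℕ) / 2 ^ n) - x (k / 2 ^ n)| ≤ S * r ^ n)
    {t : ℝ≥0} (ht : t < N) :
    ∃ l, Tendsto (fun n ↦ x (dyadicFloor n t)) atTop (𝓝 l) ∧
      ∀ n, |x (dyadicFloor n t) - l| ≤ S * r ^ n * (r / (1 - r)) := by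
  have hd : ∀ n, dist (x (dyadicFloor n t)) (x (dyadicFloor (n + 1) t)) ≤ S * r * r ^ n := by
    intro n
    rw [dist_comm, Real.dist_eq, mul_assoc, ← pow_succ']
    exact abs_dyadicFloor_succ_sub_le hS hr hx ht n
  obtain ⟨l, hl⟩ := cauchySeq_tendsto_of_complete (cauchySeq_of_le_geometric r _ hr1 hd)
  refine ⟨l, hl, fun n ↦ ?_⟩
  have := dist_le_of_le_geometric_of_tendsto r _ hr1 hd hl n
  rw [Real.dist_eq] at this
  refine this.trans_eq ?_
  have : 1 - r ≠ 0 := by linarith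
  field_simp

/-- If the dyadic increments of `x` decay geometrically on every bounded interval, then the limit
along dyadic approximations is continuous. -/
lemma continuous_of_tendsto_dyadicFloor {y : ℝ≥0 → ℝ} (hr : 0 ≤ r) (hr1 : r < 1)
    (hx : ∀ N : ℕ, ∃ S : ℝ, 0 ≤ S ∧ ∀ n k : ℕ, k < N * 2 ^ n →
      |x ((k + 1 : ℕ) / 2 ^ n) - x (k / 2 ^ n)| ≤ S * r ^ n)
    (hy : ∀ t, Tendsto (fun n ↦ x (dyadicFloor n t)) atTop (𝓝 (y t))) : Continuous y := by
  rw [continuous_iff_continuousAt]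
  intro t₀
  obtain ⟨N, hN⟩ := exists_nat_gt t₀
  obtain ⟨S, hS, hx⟩ := hx N
  have hc : ∀ t : ℝ≥0, t < N → ∀ n, |x (dyadicFloor n t) - y t| ≤ S * r ^ n * (r / (1 - r)) := by
    intro t ht n
    obtain ⟨l, hl, hl'⟩ := exists_tendsto_dyadicFloor hS hr hr1 hx ht
    rw [tendsto_nhds_unique (hy t) hl]
    exact hl' n
  -- Two approximation errors, at `s` and at `t`, plus one increment between grid points that are
  -- equal or adjacent.
  have key : ∀ n (s t : ℝ≥0), s ≤ t → t < N → t ≤ s + 1 / 2 ^ n →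
      |y t - y s| ≤ S * (2 * (r / (1 - r)) + 1) * r ^ n := by
    intro n s t hst ht h
    have h1 := abs_le.1 (hc t ht n)
    have h2 := abs_le.1 (hc s (hst.trans_lt ht) n)
    have h3 := abs_le.1 (abs_dyadicFloor_sub_dyadicFloor_le hS hr hx hst ht h)
    rw [abs_le]
    constructor <;> linarith
  have hlim : Tendsto (fun n : ℕ ↦ S * (2 * (r / (1 - r)) + 1) * r ^ n) atTop (𝓝 0) := by
    simpa using (tendsto_pow_atTop_nhds_zero_of_lt_one hr hr1).const_mul
      (S * (2 * (r / (1 - r)) + 1))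
  rw [Metric.continuousAt_iff']
  intro ε hε
  obtain ⟨n, hn⟩ := (hlim.eventually (gt_mem_nhds hε)).exists
  have e1 : ∀ᶠ t : ℝ≥0 in 𝓝 t₀, t < N := gt_mem_nhds hN
  have e2 : ∀ᶠ t in 𝓝 t₀, t < t₀ + 1 / 2 ^ n := gt_mem_nhds (lt_add_of_pos_right _ (by positivity))
  have e3 : ∀ᶠ t in 𝓝 t₀, t₀ < t + 1 / 2 ^ n := by
    have : Tendsto (fun t : ℝ≥0 ↦ t + 1 / 2 ^ n) (𝓝 t₀) (𝓝 (t₀ + 1 / 2 ^ n)) :=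
      tendsto_id.add_const _
    exact this.eventually (lt_mem_nhds (lt_add_of_pos_right _ (by positivity)))
  filter_upwards [e1, e2, e3] with t h1 h2 h3
  rw [Real.dist_eq]
  refine lt_of_le_of_lt ?_ hn
  rcases le_total t t₀ with h | h
  · rw [abs_sub_comm]
    exact key n t t₀ h hN h3.le
  · exact key n t₀ t h h1 h2.le

end Dyadic

/-! ### The Kolmogorov–Chentsov theorem. -/

section Kolmogorov

variable {Ω : Type*} [MeasurableSpace Ω] {P : Measure Ω} {X : ℝ≥0 → Ω → ℝ} {p : ℕ} {C : ℝ≥0}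

/-- A series of moments which is dominated by a geometric series bounds the variables
geometrically, almost surely. -/
lemma ae_exists_forall_abs_le_of_lintegral_le {κ : ℕ → Finset ℕ} {Z : ℕ → ℕ → Ω → ℝ}
    (hp : p ≠ 0) (hZ : ∀ n k, AEMeasurable (Z n k) P) {K : ℝ≥0}
    (h : ∀ n, ∑ k ∈ κ n, ∫⁻ ω, ‖Z n k ω‖ₑ ^ p ∂P ≤ K * (1 / 2) ^ n) :
    ∀ᵐ ω ∂P, ∃ S : ℝ, 0 ≤ S ∧ ∀ n, ∀ k ∈ κ n, |Z n k ω| ≤ S * ((2 / 3 : ℝ) ^ (1 / p : ℝ)) ^ n := by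
  have hm : ∀ n k, AEMeasurable (fun ω ↦ (3 / 2 : ℝ≥0∞) ^ n * ‖Z n k ω‖ₑ ^ p) P := fun n k ↦
    ((hZ n k).enorm.pow_const p).const_mul _
  -- The weight `(3 / 2) ^ n` still leaves a convergent series of ratio `3 / 4`. Its sum `T` is
  -- therefore almost surely finite, and bounding each term by `T` gives decay at rate `(2 / 3) ^ (n
  -- / p)`.
  have hfin : ∫⁻ ω, ∑' n, ∑ k ∈ κ n, (3 / 2 : ℝ≥0∞) ^ n * ‖Z n k ω‖ₑ ^ p ∂P ≠ ∞ := by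
    rw [lintegral_tsum fun n ↦ Finset.aemeasurable_fun_sum _ fun k _ ↦ hm n k]
    have hle : ∀ n, ∫⁻ ω, ∑ k ∈ κ n, (3 / 2 : ℝ≥0∞) ^ n * ‖Z n k ω‖ₑ ^ p ∂P
        ≤ K * (3 / 4) ^ n := fun n ↦ by
      rw [lintegral_finsetSum' _ fun k _ ↦ hm n k]
      calc _ = ∑ k ∈ κ n, (3 / 2 : ℝ≥0∞) ^ n * ∫⁻ ω, ‖Z n k ω‖ₑ ^ p ∂P :=
            Finset.sum_congr rfl fun k _ ↦ lintegral_const_mul'' _ ((hZ n k).enorm.pow_const p)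
        _ ≤ (3 / 2 : ℝ≥0∞) ^ n * (K * (1 / 2) ^ n) := by
            rw [← Finset.mul_sum]
            gcongr
            exact h n
        _ = K * (3 / 4) ^ n := by
            rw [mul_left_comm, ← mul_pow]
            congr 2
            rw [ENNReal.div_eq_inv_mul, ENNReal.div_eq_inv_mul, ENNReal.div_eq_inv_mul, mul_one,
              mul_right_comm, ← ENNReal.mul_inv (by simp) (by simp)]
            norm_num
    refine ne_top_of_le_ne_top ?_ (ENNReal.tsum_le_tsum hle)
    rw [ENNReal.tsum_mul_left, ENNReal.tsum_geometric]
    refine ENNReal.mul_ne_top (by simp) ?_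
    rw [ENNReal.inv_ne_top, ne_eq, tsub_eq_zero_iff_le, not_le]
    exact ENNReal.div_lt_of_lt_mul (by norm_num)
  filter_upwards [ae_lt_top' (AEMeasurable.tsum fun n ↦
    Finset.aemeasurable_fun_sum _ fun k _ ↦ hm n k) hfin] with ω hω
  set T := ∑' n, ∑ k ∈ κ n, (3 / 2 : ℝ≥0∞) ^ n * ‖Z n k ω‖ₑ ^ p
  refine ⟨T.toReal ^ (1 / p : ℝ), by positivity, fun n k hk ↦ ?_⟩
  have h1 : (3 / 2 : ℝ≥0∞) ^ n * ‖Z n k ω‖ₑ ^ p ≤ T :=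
    (Finset.single_le_sum (f := fun k ↦ (3 / 2 : ℝ≥0∞) ^ n * ‖Z n k ω‖ₑ ^ p)
      (fun _ _ ↦ zero_le) hk).trans
      (ENNReal.le_tsum (f := fun n ↦ ∑ k ∈ κ n, (3 / 2 : ℝ≥0∞) ^ n * ‖Z n k ω‖ₑ ^ p) n)
  have h2 : (3 / 2 : ℝ) ^ n * |Z n k ω| ^ p ≤ T.toReal := by
    have := ENNReal.toReal_mono hω.ne h1
    simpa using this
  have h3 : |Z n k ω| ^ p ≤ T.toReal * (2 / 3) ^ n := by
    have : (2 / 3 : ℝ) ^ n * (3 / 2) ^ n = 1 := by rw [← mul_pow]; norm_num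
    calc |Z n k ω| ^ p = ((3 / 2 : ℝ) ^ n * |Z n k ω| ^ p) * (2 / 3) ^ n := by
          linear_combination (-|Z n k ω| ^ p) * this
      _ ≤ _ := by gcongr
  rw [← pow_le_pow_iff_left₀ (abs_nonneg _) (by positivity) hp]
  refine h3.trans_eq ?_
  have hp' : (1 / p : ℝ) * p = 1 := by field_simp
  rw [mul_pow, ← Real.rpow_mul_natCast ENNReal.toReal_nonneg, ← pow_mul, mul_comm n, pow_mul,
    ← Real.rpow_mul_natCast (by norm_num), hp', Real.rpow_one, Real.rpow_one]

/-- **Kolmogorov–Chentsov**: a real process on `[0, ∞)` whose increments have a `p`-th moment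
dominated by the square of the time lag has a modification with continuous paths. -/
theorem exists_continuous_modification (hp : p ≠ 0) (hX : ∀ t, AEMeasurable (X t) P)
    (h : ∀ s t : ℝ≥0, |(s : ℝ) - t| ≤ 1 →
      ∫⁻ ω, ‖X s ω - X t ω‖ₑ ^ p ∂P ≤ C * ENNReal.ofReal (|(s : ℝ) - t| ^ 2)) :
    ∃ X' : ℝ≥0 → Ω → ℝ, (∀ t, X' t =ᵐ[P] X t) ∧ ∀ᵐ ω ∂P, Continuous fun t ↦ X' t ω := by
  set r : ℝ := (2 / 3 : ℝ) ^ (1 / p : ℝ) with hr_def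
  have hr : 0 ≤ r := by positivity
  have hr1 : r < 1 := Real.rpow_lt_one (by norm_num) (by norm_num) (by positivity)
  have hpow : ∀ n : ℕ, ENNReal.ofReal ((1 / 2 ^ n : ℝ) ^ 2) = (1 / 4) ^ n := fun n ↦ by
    rw [← one_div_pow, ← pow_mul, mul_comm, pow_mul, ENNReal.ofReal_pow (by norm_num)]
    congr 1
    rw [one_div, one_div, inv_pow, ENNReal.ofReal_inv_of_pos (by norm_num)]
    norm_num
  have hone : ∀ n : ℕ, (1 / 2 ^ n : ℝ) ≤ 1 := fun n ↦ by
    rw [← one_div_pow]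
    exact pow_le_one₀ (by norm_num) (by norm_num)
  have hquarter : (1 / 4 : ℝ≥0∞) = 1 / 2 * (1 / 2) := by
    rw [one_div, one_div, ← ENNReal.mul_inv (by simp) (by simp)]
    norm_num
  -- At level `n` there are `N * 2 ^ n` increments with moments at most `C * 4 ^ (-n)`, for a total
  -- of `C * N * 2 ^ (-n)`.
  have hinc : ∀ᵐ ω ∂P, ∀ N : ℕ, ∃ S : ℝ, 0 ≤ S ∧ ∀ n k : ℕ, k < N * 2 ^ n →
      |X ((k + 1 : ℕ) / 2 ^ n) ω - X (k / 2 ^ n) ω| ≤ S * r ^ n := by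
    rw [ae_all_iff]
    intro N
    have := ae_exists_forall_abs_le_of_lintegral_le (P := P) (p := p) (K := C * N)
      (κ := fun n ↦ Finset.range (N * 2 ^ n))
      (Z := fun n k ω ↦ X ((k + 1 : ℕ) / 2 ^ n) ω - X (k / 2 ^ n) ω) hp
      (fun n k ↦ (hX _).sub (hX _)) (fun n ↦ ?_)
    · simpa only [Finset.mem_range] using this
    · have hle : ∀ k : ℕ, ∫⁻ ω, ‖X ((k + 1 : ℕ) / 2 ^ n) ω - X (k / 2 ^ n) ω‖ₑ ^ p ∂P
          ≤ C * (1 / 4) ^ n := fun k ↦ by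
        have hk : |(((k + 1 : ℕ) / 2 ^ n : ℝ≥0) : ℝ) - ((k / 2 ^ n : ℝ≥0) : ℝ)| = 1 / 2 ^ n := by
          push_cast
          rw [← sub_div, add_sub_cancel_left, abs_of_pos (by positivity)]
        have := h ((k + 1 : ℕ) / 2 ^ n) (k / 2 ^ n) (by rw [hk]; exact hone n)
        rwa [hk, hpow] at this
      refine (Finset.sum_le_sum fun k _ ↦ hle k).trans_eq ?_
      rw [Finset.sum_const, Finset.card_range, nsmul_eq_mul, hquarter, mul_pow]
      have : (2 : ℝ≥0∞) ^ n * (1 / 2) ^ n = 1 := by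
        rw [← mul_pow, one_div, ENNReal.mul_inv_cancel (by simp) (by simp), one_pow]
      push_cast
      calc (N * 2 ^ n : ℝ≥0∞) * (C * ((1 / 2) ^ n * (1 / 2) ^ n))
          = C * N * (1 / 2) ^ n * (2 ^ n * (1 / 2) ^ n) := by ring
        _ = _ := by rw [this, mul_one]
  -- The same moment bound at a fixed time, one variable per level, identifies the dyadic limit with
  -- `X t`.
  have hpt : ∀ t, ∀ᵐ ω ∂P, Tendsto (fun n ↦ X (dyadicFloor n t) ω) atTop (𝓝 (X t ω)) := by
    intro t
    have := ae_exists_forall_abs_le_of_lintegral_le (P := P) (p := p) (K := C)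
      (κ := fun n ↦ {0}) (Z := fun n k ω ↦ X (dyadicFloor n t) ω - X t ω) hp
      (fun n k ↦ (hX _).sub (hX _)) (fun n ↦ ?_)
    · filter_upwards [this] with ω hω
      obtain ⟨S, -, hS⟩ := hω
      rw [tendsto_iff_norm_sub_tendsto_zero]
      refine squeeze_zero (fun _ ↦ norm_nonneg _) (fun n ↦ hS n 0 (by simp)) ?_
      simpa only [mul_zero] using (tendsto_pow_atTop_nhds_zero_of_lt_one hr hr1).const_mul S
    · rw [Finset.sum_singleton]
      have hd := abs_dyadicFloor_sub_le n t
      refine (h _ _ (hd.trans (hone n))).trans ?_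
      gcongr
      calc ENNReal.ofReal (|(dyadicFloor n t : ℝ) - t| ^ 2)
          ≤ ENNReal.ofReal ((1 / 2 ^ n) ^ 2) := by gcongr
        _ = (1 / 4) ^ n := hpow n
        _ ≤ (1 / 2) ^ n := by
          gcongr
          norm_num
  -- The arbitrary value of `limUnder` without convergence only matters on null sets.
  refine ⟨fun t ω ↦ limUnder atTop fun n ↦ X (dyadicFloor n t) ω, fun t ↦ ?_, ?_⟩
  · filter_upwards [hpt t] with ω hω using hω.limUnder_eq
  · filter_upwards [hinc] with ω hω
    refine continuous_of_tendsto_dyadicFloor (x := fun t ↦ X t ω) hr hr1 hω fun t ↦ ?_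
    obtain ⟨N, hN⟩ := exists_nat_gt t
    obtain ⟨S, hS, hx⟩ := hω N
    obtain ⟨l, hl, -⟩ := exists_tendsto_dyadicFloor (x := fun t ↦ X t ω) hS hr hr1 hx hN
    exact tendsto_nhds_limUnder ⟨l, hl⟩

end Kolmogorov

/-! ### Gaussian sequences with decaying correlations. -/

section Gaussian

variable {Ω : Type*} [MeasurableSpace Ω] {P : Measure Ω}

lemma one_sub_cos_le_abs (u : ℝ) : 1 - Real.cos u ≤ |u| := by
  rcases le_total |u| 2 with h | h
  · have h1 := Real.one_sub_sq_div_two_le_cos (x := u)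
    rw [← sq_abs] at h1
    nlinarith [abs_nonneg u]
  · linarith [Real.neg_one_le_cos u]

/-- The second moment of the sum of a sequence with geometrically decaying correlations grows at
most linearly. -/
lemma integral_sum_sq_le {ξ : ℕ → Ω → ℝ} {K r : ℝ} (hK : 0 ≤ K) (hr : 0 ≤ r) (hr1 : r < 1)
    (hξ : ∀ i, MemLp (ξ i) 2 P) (hd : ∀ i, ∫ ω, ξ i ω * ξ i ω ∂P ≤ K)
    (ho : ∀ i j, i < j → ∫ ω, ξ i ω * ξ j ω ∂P ≤ K * r ^ (j - i)) (n : ℕ) :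
    ∫ ω, (∑ i ∈ Finset.range n, ξ i ω) ^ 2 ∂P ≤ (K + 2 * (K / (1 - r))) * n := by
  induction n with
  | zero => simp
  | succ n ih =>
    have hS : MemLp (fun ω ↦ ∑ i ∈ Finset.range n, ξ i ω) 2 P :=
      memLp_finsetSum _ fun i _ ↦ hξ i
    have hc : ∫ ω, (∑ i ∈ Finset.range n, ξ i ω) * ξ n ω ∂P ≤ K / (1 - r) := by
      simp_rw [Finset.sum_mul]
      rw [integral_finsetSum (f := fun i ω ↦ ξ i ω * ξ n ω) _ fun i _ ↦ (hξ i).integrable_mul (hξ n)]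
      calc _ ≤ ∑ i ∈ Finset.range n, K * r ^ (n - i) :=
            Finset.sum_le_sum fun i hi ↦ ho i n (Finset.mem_range.1 hi)
        -- Lowering the exponent by one lets reflection turn the sum into the geometric series from
        -- `i = 0`. The cross term is thus bounded uniformly in `n`, and each new variable adds at
        -- most a constant.
        _ ≤ ∑ i ∈ Finset.range n, K * r ^ (n - 1 - i) := by
            refine Finset.sum_le_sum fun i _ ↦ ?_
            gcongr 1
            exact pow_le_pow_of_le_one hr hr1.le (by omega)
        _ = K * ∑ i ∈ Finset.range n, r ^ i := by
            rw [Finset.sum_range_reflect (fun i ↦ K * r ^ i), Finset.mul_sum]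
        _ ≤ K * (1 - r)⁻¹ := by
            gcongr
            rw [← tsum_geometric_of_lt_one hr hr1]
            exact (summable_geometric_of_lt_one hr hr1).sum_le_tsum _ fun _ _ ↦ by positivity
        _ = _ := (div_eq_mul_inv _ _).symm
    have e : ∀ ω, (∑ i ∈ Finset.range (n + 1), ξ i ω) ^ 2 =
        (∑ i ∈ Finset.range n, ξ i ω) ^ 2 + 2 * ((∑ i ∈ Finset.range n, ξ i ω) * ξ n ω)
          + ξ n ω * ξ n ω := fun ω ↦ by
      rw [Finset.sum_range_succ]
      ring
    have i1 := hS.integrable_sq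
    have i2 : Integrable (fun ω ↦ 2 * ((∑ i ∈ Finset.range n, ξ i ω) * ξ n ω)) P :=
      (hS.integrable_mul (hξ n)).const_mul 2
    have i3 : Integrable (fun ω ↦ ξ n ω * ξ n ω) P := (hξ n).integrable_mul (hξ n)
    simp_rw [e]
    rw [integral_add (i1.fun_add i2) i3, integral_add i1 i2, integral_const_mul]
    push_cast
    linarith [hd n]

/-- The real part of the characteristic function at `1`. -/
lemma ProbabilityTheory.HasGaussianLaw.integral_cos {X : Ω → ℝ} (hX : HasGaussianLaw X P)
    (h0 : ∫ ω, X ω ∂P = 0) : ∫ ω, Real.cos (X ω) ∂P = Real.exp (-Var[X; P] / 2) := by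
  have := hX.isProbabilityMeasure
  have h := hX.charFun_map_eq 1
  have e : charFun (P.map X) 1 = ∫ ω, Complex.exp (X ω * Complex.I) ∂P := by
    rw [charFun_apply_real, integral_map hX.aemeasurable (by fun_prop)]
    simp
  have hint : Integrable (fun ω ↦ Complex.exp (X ω * Complex.I)) P := by
    refine Integrable.of_bound (C := 1) ?_ (ae_of_all _ fun ω ↦ ?_)
    · exact (Measurable.comp_aemeasurable (g := fun x : ℝ ↦ Complex.exp (x * Complex.I))
        (by fun_prop) hX.aemeasurable).aestronglyMeasurable
    · rw [Complex.norm_exp_ofReal_mul_I]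
  rw [e] at h
  have h2 := congrArg Complex.re h
  have h3 : ∫ ω, (Complex.exp (X ω * Complex.I)).re ∂P =
      (∫ ω, Complex.exp (X ω * Complex.I) ∂P).re := integral_re hint
  rw [← h3] at h2
  simp only [Complex.exp_ofReal_mul_I_re] at h2
  rw [h2]
  simp only [RCLike.inner_apply, map_one, mul_one, h0]
  rw [show ((0 : ℝ) : ℂ) * Complex.I - (Var[fun ω ↦ X ω; P] : ℂ) / 2 =
    ((-Var[X; P] / 2 : ℝ) : ℂ) by push_cast; ring, Complex.exp_ofReal_re]

/-- With `ρ` the covariance, `U ± V` have variance `2 ± 2ρ`, so the product-to-sum formula evaluates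
the integral as `exp (-1) * (cosh ρ - 1)`. The centered cosines thus inherit the decay of
correlations. -/
lemma integral_cos_mul_cos_le {U V : Ω → ℝ} (hUV : HasGaussianLaw (fun ω ↦ (U ω, V ω)) P)
    (hU0 : ∫ ω, U ω ∂P = 0) (hV0 : ∫ ω, V ω ∂P = 0) (hU1 : Var[U; P] = 1)
    (hV1 : Var[V; P] = 1) :
    ∫ ω, (Real.cos (U ω) - Real.exp (-1 / 2)) * (Real.cos (V ω) - Real.exp (-1 / 2)) ∂P
      ≤ |cov[U, V; P]| := by
  have := hUV.isProbabilityMeasure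
  have hU := hUV.fst
  have hV := hUV.snd
  set ρ := cov[U, V; P] with hρ
  have hva : Var[fun ω ↦ U ω + V ω; P] = 2 + 2 * ρ := by
    rw [variance_fun_add hU.memLp_two hV.memLp_two, hU1, hV1]
    ring
  have hvs : Var[fun ω ↦ U ω - V ω; P] = 2 - 2 * ρ := by
    rw [variance_fun_sub hU.memLp_two hV.memLp_two, hU1, hV1]
    ring
  have hρ1 : |ρ| ≤ 1 := by
    have h1 := variance_nonneg (fun ω ↦ U ω + V ω) P
    have h2 := variance_nonneg (fun ω ↦ U ω - V ω) P
    rw [abs_le]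
    constructor <;> linarith
  have ca := hUV.fun_add.integral_cos (by
    rw [integral_add hU.integrable hV.integrable, hU0, hV0, add_zero])
  have cs := hUV.fun_sub.integral_cos (by
    rw [integral_sub hU.integrable hV.integrable, hU0, hV0, sub_zero])
  have cu := hU.integral_cos hU0
  have cv := hV.integral_cos hV0
  rw [hva] at ca
  rw [hvs] at cs
  rw [hU1] at cu
  rw [hV1] at cv
  have hint : ∀ {W : Ω → ℝ}, AEMeasurable W P → Integrable (fun ω ↦ Real.cos (W ω)) P := by
    intro W hW
    refine Integrable.of_bound (C := 1)
      (Real.continuous_cos.measurable.comp_aemeasurable hW).aestronglyMeasurable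
      (ae_of_all _ fun ω ↦ ?_)
    exact Real.abs_cos_le_one _
  have e : ∀ ω, (Real.cos (U ω) - Real.exp (-1 / 2)) * (Real.cos (V ω) - Real.exp (-1 / 2)) =
      1 / 2 * Real.cos (U ω + V ω) + 1 / 2 * Real.cos (U ω - V ω)
        + -Real.exp (-1 / 2) * Real.cos (U ω) + -Real.exp (-1 / 2) * Real.cos (V ω)
        + Real.exp (-1 / 2) * Real.exp (-1 / 2) := fun ω ↦ by
    rw [Real.cos_add, Real.cos_sub]
    ring
  have i1 := (hint (hU.aemeasurable.fun_add hV.aemeasurable)).const_mul (1 / 2)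
  have i2 := (hint (hU.aemeasurable.fun_sub hV.aemeasurable)).const_mul (1 / 2)
  have i3 := (hint hU.aemeasurable).const_mul (-Real.exp (-1 / 2))
  have i4 := (hint hV.aemeasurable).const_mul (-Real.exp (-1 / 2))
  simp_rw [e]
  rw [integral_add (((i1.fun_add i2).fun_add i3).fun_add i4) (integrable_const _),
    integral_add ((i1.fun_add i2).fun_add i3) i4, integral_add (i1.fun_add i2) i3,
    integral_add i1 i2,
    integral_const_mul, integral_const_mul, integral_const_mul, integral_const_mul]
  rw [ca, cs, cu, cv, integral_const, probReal_univ, one_smul]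
  have e1 : Real.exp (-(2 + 2 * ρ) / 2) = Real.exp (-1) * Real.exp (-ρ) := by
    rw [← Real.exp_add]
    ring_nf
  have e2 : Real.exp (-(2 - 2 * ρ) / 2) = Real.exp (-1) * Real.exp ρ := by
    rw [← Real.exp_add]
    ring_nf
  have e3 : Real.exp (-1 / 2) * Real.exp (-1 / 2) = Real.exp (-1) := by
    rw [← Real.exp_add]
    norm_num
  -- From `cosh ρ ≤ exp (ρ² / 2)` and `|exp x - 1| ≤ 2|x|` for `|x| ≤ 1`; then `ρ² ≤ |ρ|`.
  have hcosh : Real.cosh ρ - 1 ≤ |ρ| := by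
    have h1 := Real.cosh_le_exp_half_sq ρ
    have h2 : ρ ^ 2 ≤ |ρ| := by
      rw [← sq_abs]
      nlinarith [abs_nonneg ρ]
    have h3 := Real.abs_exp_sub_one_le (x := ρ ^ 2 / 2) (by
      rw [abs_of_nonneg (by positivity)]; linarith)
    rw [abs_of_nonneg (show 0 ≤ ρ ^ 2 / 2 by positivity)] at h3
    linarith [le_abs_self (Real.exp (ρ ^ 2 / 2) - 1)]
  rw [e1, e2]
  have hexp : Real.exp (-1) ≤ 1 := Real.exp_le_one_iff.2 (by norm_num)
  calc _ = Real.exp (-1) * (Real.cosh ρ - 1) := by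
        rw [Real.cosh_eq]
        linear_combination (-1 : ℝ) * e3
    _ ≤ 1 * |ρ| := mul_le_mul hexp hcosh (by linarith [Real.one_le_cosh ρ]) zero_le_one
    _ = |ρ| := one_mul _

/-- A standardized Gaussian sequence with geometrically decaying correlations almost surely takes
a value above a positive threshold. -/
lemma ProbabilityTheory.IsGaussianProcess.ae_exists_lt {U : ℕ → Ω → ℝ}
    (hU : IsGaussianProcess U P) (h0 : ∀ i, ∫ ω, U i ω ∂P = 0) (h1 : ∀ i, Var[U i; P] = 1)
    {K r : ℝ} (hK : 1 ≤ K) (hr : 0 ≤ r) (hr1 : r < 1)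
    (hc : ∀ i j, i < j → |cov[U i, U j; P]| ≤ K * r ^ (j - i)) :
    ∀ᵐ ω ∂P, ∃ i, 1 / 10 < U i ω := by
  have := hU.isProbabilityMeasure
  set c := Real.exp (-1 / 2) with hcdef
  have hUm : ∀ i, MemLp (U i) 2 P := fun i ↦ (hU.hasGaussianLaw_eval i).memLp_two
  have hmul : ∀ i j, ∫ ω, U i ω * U j ω ∂P = cov[U i, U j; P] := fun i j ↦ by
    rw [covariance_eq_sub (hUm i) (hUm j), h0 i]
    simp
  have hcm : ∀ i, MemLp (fun ω ↦ Real.cos (U i ω) - c) 2 P := fun i ↦ by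
    refine MemLp.sub (MemLp.of_bound (C := 1) ?_ (ae_of_all _ fun ω ↦ Real.abs_cos_le_one _))
      (memLp_const c)
    exact (Real.continuous_cos.measurable.comp_aemeasurable (hU.aemeasurable i)).aestronglyMeasurable
  set K' := K + 2 * (K / (1 - r)) with hK'
  have bS := integral_sum_sq_le (P := P) (ξ := U) (K := K) (by linarith) hr hr1 hUm
    (fun i ↦ by rw [hmul, covariance_self (hU.aemeasurable i), h1]; exact hK)
    (fun i j hij ↦ by rw [hmul]; exact (le_abs_self _).trans (hc i j hij))
  have bT := integral_sum_sq_le (P := P) (ξ := fun i ω ↦ Real.cos (U i ω) - c) (K := K)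
    (by linarith) hr hr1 hcm
    (fun i ↦ (integral_cos_mul_cos_le hU.hasGaussianLaw_prodMk (h0 i) (h0 i) (h1 i) (h1 i)).trans
      (by rw [covariance_self (hU.aemeasurable i), h1]; simpa))
    (fun i j hij ↦ (integral_cos_mul_cos_le hU.hasGaussianLaw_prodMk (h0 i) (h0 j) (h1 i)
      (h1 j)).trans (hc i j hij))
  set A := {ω | ¬ ∃ i, 1 / 10 < U i ω} with hA
  have hc23 : c ≤ 2 / 3 := by
    have : c * Real.exp (1 / 2) = 1 := by
      rw [hcdef, ← Real.exp_add]
      norm_num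
    nlinarith [Real.add_one_le_exp (1 / 2 : ℝ), Real.exp_pos (-1 / 2 : ℝ)]
  -- If no `U i` exceeds `1 / 10`, the sums satisfy `T - S ≥ 2n / 15`. Both second moments are at
  -- most `K' * n`, so Chebyshev bounds the probability by a multiple of `1 / n`.
  have key : ∀ n : ℕ, 0 < n → P.real A * (2 / 15) ^ 2 * n ≤ 4 * K' := by
    intro n hn
    set S : Ω → ℝ := fun ω ↦ ∑ i ∈ Finset.range n, U i ω
    set T : Ω → ℝ := fun ω ↦ ∑ i ∈ Finset.range n, (Real.cos (U i ω) - c)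
    have hSi : Integrable (fun ω ↦ S ω ^ 2) P :=
      (memLp_finsetSum _ fun i _ ↦ hUm i : MemLp S 2 P).integrable_sq
    have hTi : Integrable (fun ω ↦ T ω ^ 2) P :=
      (memLp_finsetSum _ fun i _ ↦ hcm i : MemLp T 2 P).integrable_sq
    have hsub : A ⊆ {ω | (2 / 15 * n) ^ 2 ≤ 2 * T ω ^ 2 + 2 * S ω ^ 2} := by
      intro ω hω
      simp only [hA, mem_ofPred_eq, not_exists, not_lt] at hω
      -- For `0 ≤ u ≤ 1 / 10`, `cos u - c - u ≥ 1 - 2u - c ≥ 1 - 1 / 5 - 2 / 3 = 2 / 15`. For `u <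
      -- 0` the two `|u|` cancel, leaving `1 - c`: the cosine compensates values near zero, where
      -- `-u` alone gives no gain.
      have hle : ∀ i, 2 / 15 ≤ (Real.cos (U i ω) - c) - U i ω := by
        intro i
        have ha := one_sub_cos_le_abs (U i ω)
        have hb := hω i
        rcases abs_cases (U i ω) with ⟨h, -⟩ | ⟨h, -⟩ <;> linarith
      have hsum : 2 / 15 * n ≤ T ω - S ω := by
        simp only [T, S]
        rw [← Finset.sum_sub_distrib]
        refine le_trans ?_ (Finset.sum_le_sum fun i _ ↦ hle i)
        simp [mul_comm]
      have : (2 / 15 * n : ℝ) ^ 2 ≤ (T ω - S ω) ^ 2 := by gcongr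
      simp only [mem_ofPred_eq]
      nlinarith [sq_nonneg (T ω + S ω)]
    have hmark := mul_meas_ge_le_integral_of_nonneg (μ := P)
      (f := fun ω ↦ 2 * T ω ^ 2 + 2 * S ω ^ 2) (ae_of_all _ fun ω ↦ by positivity)
      ((hTi.const_mul 2).add (hSi.const_mul 2)) ((2 / 15 * n) ^ 2)
    rw [integral_add (hTi.const_mul 2) (hSi.const_mul 2), integral_const_mul,
      integral_const_mul] at hmark
    have hmono := measureReal_mono (μ := P) hsub
    have hn' : (0 : ℝ) < n := by exact_mod_cast hn
    have h2 : (2 / 15 * n : ℝ) ^ 2 * P.real A ≤ 4 * (K' * n) := by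
      have := mul_le_mul_of_nonneg_left hmono (sq_nonneg (2 / 15 * n : ℝ))
      linarith [bS n, bT n]
    refine le_of_mul_le_mul_right ?_ hn'
    linarith
  have hzero : P.real A = 0 := by
    by_contra hne
    have hpos : 0 < P.real A := lt_of_le_of_ne measureReal_nonneg (Ne.symm hne)
    obtain ⟨n, hn⟩ := exists_nat_gt (4 * K' / (P.real A * (2 / 15) ^ 2))
    rw [div_lt_iff₀ (by positivity)] at hn
    have hn0 : 0 < n := by
      rcases Nat.eq_zero_or_pos n with rfl | h
      · have : 0 ≤ K / (1 - r) := div_nonneg (by linarith) (by linarith)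
        simp at hn
        linarith
      · exact h
    linarith [key n hn0]
  rw [ae_iff]
  exact (measureReal_eq_zero_iff (by finiteness)).1 hzero

end Gaussian

/-! ### Fractional Brownian motion hits every nonnegative level. -/

/-- The covariance of fractional Brownian motion at times `s < t` is nonnegative and small when
`s / t` is small. -/
lemma rpow_covariance_bounds {H s t : ℝ} (hH : 0 < H) (hH1 : H < 1) (hs : 0 < s)
    (hst : s < t) :
    0 ≤ s ^ (2 * H) + t ^ (2 * H) - (t - s) ^ (2 * H) ∧
    s ^ (2 * H) + t ^ (2 * H) - (t - s) ^ (2 * H) ≤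
      s ^ H * t ^ H * ((s / t) ^ H + 2 * (s / t) ^ (1 - H)) := by
  have ht : 0 < t := hs.trans hst
  have hts : 0 ≤ t - s := by linarith
  set x := s / t with hx
  have hx0 : 0 < x := by positivity
  have hx1 : x < 1 := (div_lt_one ht).2 hst
  have hs' : s = x * t := (div_mul_cancel₀ s ht.ne').symm
  constructor
  · have : (t - s) ^ (2 * H) ≤ t ^ (2 * H) := by
      gcongr
      linarith
    have := Real.rpow_nonneg hs.le (2 * H)
    linarith
  -- Bernoulli's inequality if `2H ≥ 1`; otherwise `(1 - x) ^ (2H) ≥ 1 - x`.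
  · have hb : 1 - 2 * x ≤ (1 - x) ^ (2 * H) := by
      rcases le_total 1 (2 * H) with h | h
      · have := one_add_mul_self_le_rpow_one_add (s := -x) (by linarith) h
        rw [← sub_eq_add_neg] at this
        nlinarith
      · have := Real.rpow_le_rpow_of_exponent_ge (x := 1 - x) (by linarith) (by linarith) h
        rw [Real.rpow_one] at this
        linarith
    have e1 : (t - s) ^ (2 * H) = (1 - x) ^ (2 * H) * t ^ (2 * H) := by
      rw [← Real.mul_rpow (by linarith) ht.le, hs']
      ring_nf
    have e2 : s ^ (2 * H) = x ^ (2 * H) * t ^ (2 * H) := by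
      rw [hs', Real.mul_rpow hx0.le ht.le]
    have e3 : s ^ H * t ^ H = x ^ H * t ^ (2 * H) := by
      rw [hs', Real.mul_rpow hx0.le ht.le, mul_assoc, ← Real.rpow_add ht, two_mul]
    have e4 : x ^ H * x ^ H = x ^ (2 * H) := by rw [← Real.rpow_add hx0, two_mul]
    have e5 : x ^ H * x ^ (1 - H) = x := by
      rw [← Real.rpow_add hx0]
      simp
    rw [e1, e2, e3]
    have e6 : x ^ H * t ^ (2 * H) * (x ^ H + 2 * x ^ (1 - H)) =
        (x ^ (2 * H) + 2 * x) * t ^ (2 * H) := by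
      linear_combination t ^ (2 * H) * e4 + 2 * t ^ (2 * H) * e5
    rw [e6]
    have := mul_le_mul_of_nonneg_right hb (Real.rpow_nonneg ht.le (2 * H))
    linarith

namespace IsFractionalBrownian

variable {Ω : Type*} [MeasurableSpace Ω] {P : Measure Ω} {Y : ℝ≥0 → Ω → ℝ} {H v : ℝ}

lemma variance_eq (hY : IsFractionalBrownian Y H v P) (t : ℝ≥0) :
    Var[Y t; P] = v * (t : ℝ) ^ (2 * H) := by
  have h := hY.covariance_eq t t
  rw [covariance_self (hY.isGaussianProcess.aemeasurable t), sub_self, abs_zero,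
    Real.zero_rpow (by linarith [hY.hurst_pos])] at h
  rw [h]
  ring

lemma zero_ae_eq_zero (hY : IsFractionalBrownian Y H v P) : ∀ᵐ ω ∂P, Y 0 ω = 0 := by
  have hm := (hY.isGaussianProcess.hasGaussianLaw_eval 0).memLp_two
  have := hY.isGaussianProcess.isProbabilityMeasure
  have h := hY.variance_eq 0
  rw [NNReal.coe_zero, Real.zero_rpow (by linarith [hY.hurst_pos]), mul_zero] at h
  have h2 : evariance (Y 0) P = 0 := by
    rw [← hm.ofReal_variance_eq, h, ENNReal.ofReal_zero]
  rw [evariance_eq_zero_iff hm.aestronglyMeasurable.aemeasurable, hY.mean_zero] at h2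
  exact h2

/-- Along geometric times the normalized variables have correlations decaying geometrically in `j -
i`. `T` is chosen so that exceeding a tenth of a standard deviation at any time from `T` on already
means exceeding `a`. -/
lemma ae_exists_ge (hY : IsFractionalBrownian Y H v P) (a : ℝ) : ∀ᵐ ω ∂P, ∃ t, a ≤ Y t ω := by
  have := hY.isGaussianProcess.isProbabilityMeasure
  have hH := hY.hurst_pos
  have hH1 := hY.hurst_lt_one
  have hv := hY.var_pos
  have hlim : Tendsto (fun T : ℝ ↦ 1 / 10 * √v * T ^ H) atTop atTop :=
    (tendsto_rpow_atTop hH).const_mul_atTop (by positivity)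
  obtain ⟨T, hT0, hTa⟩ := ((eventually_gt_atTop 0).and (hlim.eventually_ge_atTop a)).exists
  let τ : ℕ → ℝ≥0 := fun i ↦ ⟨T, hT0.le⟩ * 2 ^ i
  have hτ : ∀ i, (τ i : ℝ) = T * 2 ^ i := fun i ↦ by simp [τ]; rfl
  have hτ0 : ∀ i, (0 : ℝ) < τ i := fun i ↦ by rw [hτ]; positivity
  let c : ℕ → ℝ := fun i ↦ (√v * (τ i : ℝ) ^ H)⁻¹
  have hc0 : ∀ i, 0 < c i := fun i ↦ by
    have := hτ0 i
    positivity
  set r := max ((1 / 2 : ℝ) ^ H) ((1 / 2 : ℝ) ^ (1 - H)) with hr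
  have hr0 : 0 ≤ r := le_max_of_le_left (by positivity)
  have hr1 : r < 1 := max_lt (Real.rpow_lt_one (by norm_num) (by norm_num) hH)
    (Real.rpow_lt_one (by norm_num) (by norm_num) (by linarith))
  have hvv : √v * √v = v := Real.mul_self_sqrt hv.le
  have hG : IsGaussianProcess (fun i ω ↦ c i • (Y ∘ τ) i ω) P :=
    (hY.isGaussianProcess.comp_right τ).smul c
  -- The covariance bound gives `3 / 2 * r ^ (j - i)`, rounded up to `K = 2`.
  have hlt := hG.ae_exists_lt (K := 2) (r := r) (fun i ↦ ?_) (fun i ↦ ?_) (by norm_num) hr0 hr1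
    (fun i j hij ↦ ?_)
  · filter_upwards [hlt] with ω ⟨i, hi⟩
    refine ⟨τ i, hTa.trans ?_⟩
    have h1 : 1 / 10 * (√v * (τ i : ℝ) ^ H) < Y (τ i) ω := by
      have := hτ0 i
      have hp : 0 < √v * (τ i : ℝ) ^ H := by positivity
      simp only [c, Function.comp_apply, smul_eq_mul] at hi
      rwa [inv_mul_eq_div, lt_div_iff₀ hp] at hi
    refine le_trans ?_ h1.le
    rw [mul_assoc]
    gcongr
    rw [hτ]
    exact le_mul_of_one_le_right hT0.le (one_le_pow₀ (by norm_num))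
  · simp only [smul_eq_mul, Function.comp_apply]
    rw [integral_const_mul, hY.mean_zero, mul_zero]
  · simp only [smul_eq_mul, Function.comp_apply]
    rw [variance_const_mul, hY.variance_eq]
    have e : (τ i : ℝ) ^ (2 * H) = (τ i : ℝ) ^ H * (τ i : ℝ) ^ H := by
      rw [← Real.rpow_add (hτ0 i), two_mul]
    have hp : 0 < (τ i : ℝ) ^ H := Real.rpow_pos_of_pos (hτ0 i) _
    have hsv : 0 < √v := Real.sqrt_pos.2 hv
    simp only [c]
    rw [e]
    nth_rw 2 [← hvv]
    field_simp
  · simp only [smul_eq_mul, Function.comp_apply]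
    have hlt : (τ i : ℝ) < τ j := by
      rw [hτ, hτ]
      gcongr
      norm_num
    rw [covariance_const_mul_left, covariance_const_mul_right, hY.covariance_eq, abs_sub_comm,
      abs_of_pos (sub_pos.2 hlt)]
    obtain ⟨b1, b2⟩ := rpow_covariance_bounds hH hH1 (hτ0 i) hlt
    have hx : (τ i : ℝ) / τ j = (1 / 2) ^ (j - i) := by
      rw [hτ, hτ, one_div_pow, div_eq_div_iff (by positivity) (by positivity), one_mul, mul_assoc,
        ← pow_add, Nat.add_sub_cancel' hij.le]
    have hpow : ∀ p : ℝ, ((1 / 2 : ℝ) ^ (j - i)) ^ p = ((1 / 2 : ℝ) ^ p) ^ (j - i) := fun p ↦ by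
      rw [← Real.rpow_natCast_mul (by norm_num), mul_comm, Real.rpow_mul_natCast (by norm_num)]
    have hle : ((τ i : ℝ) / τ j) ^ H + 2 * ((τ i : ℝ) / τ j) ^ (1 - H) ≤ 3 * r ^ (j - i) := by
      have h1 : ((1 / 2 : ℝ) ^ H) ^ (j - i) ≤ r ^ (j - i) := by
        gcongr
        exact le_max_left _ _
      have h2 : ((1 / 2 : ℝ) ^ (1 - H)) ^ (j - i) ≤ r ^ (j - i) := by
        gcongr
        exact le_max_right _ _
      rw [hx, hpow, hpow]
      linarith
    have hpi : 0 < (τ i : ℝ) ^ H := Real.rpow_pos_of_pos (hτ0 i) _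
    have hpj : 0 < (τ j : ℝ) ^ H := Real.rpow_pos_of_pos (hτ0 j) _
    have hsv : 0 < √v := Real.sqrt_pos.2 hv
    have e : c i * (c j * (v / 2 * ((τ i : ℝ) ^ (2 * H) + (τ j : ℝ) ^ (2 * H)
        - ((τ j : ℝ) - τ i) ^ (2 * H)))) =
        ((τ i : ℝ) ^ (2 * H) + (τ j : ℝ) ^ (2 * H) - ((τ j : ℝ) - τ i) ^ (2 * H)) /
          (2 * ((τ i : ℝ) ^ H * (τ j : ℝ) ^ H)) := by
      simp only [c]
      nth_rw 3 [← hvv]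
      field_simp
    rw [e, abs_of_nonneg (by positivity), div_le_iff₀ (by positivity)]
    refine b2.trans ?_
    have hr' : 0 ≤ r ^ (j - i) := by positivity
    calc _ ≤ (τ i : ℝ) ^ H * (τ j : ℝ) ^ H * (3 * r ^ (j - i)) := by gcongr
      _ ≤ (τ i : ℝ) ^ H * (τ j : ℝ) ^ H * (4 * r ^ (j - i)) := by gcongr; norm_num
      _ = _ := by ring

lemma ae_exists_eq (hY : IsFractionalBrownian Y H v P) (s : ℝ≥0) :
    ∀ᵐ ω ∂P, ∃ t, Y t ω = s := by
  filter_upwards [hY.ae_exists_ge s, hY.zero_ae_eq_zero, hY.continuous_paths] with ω ⟨t, ht⟩ h0 hc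
  exact mem_range_of_exists_le_of_exists_ge hc ⟨0, by simp [h0]⟩ ⟨t, ht⟩

lemma ae_levelHittingTime_lt_top (hY : IsFractionalBrownian Y H v P) (s : ℝ≥0) :
    ∀ᵐ ω ∂P, levelHittingTime Y s ω < ⊤ := by
  filter_upwards [hY.ae_exists_eq s] with ω ⟨t, ht⟩
  rw [lt_top_iff_ne_top, levelHittingTime, ne_eq, hittingAfter_eq_top_iff]
  exact fun h ↦ h t zero_le ht

/-- By continuity the set of times at the level is closed, so its infimum belongs to it. -/
lemma ae_stoppedValue_levelHittingTime (hY : IsFractionalBrownian Y H v P) (s : ℝ≥0) :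
    ∀ᵐ ω ∂P, stoppedValue Y (levelHittingTime Y s) ω = s := by
  filter_upwards [hY.ae_exists_eq s, hY.continuous_paths] with ω ⟨t, ht⟩ hc
  have hne : ∃ j, 0 ≤ j ∧ Y j ω ∈ ({(s : ℝ)} : Set ℝ) := ⟨t, zero_le, ht⟩
  have hmem : sInf {j : ℝ≥0 | 0 ≤ j ∧ Y j ω ∈ ({(s : ℝ)} : Set ℝ)} ∈
      {j : ℝ≥0 | 0 ≤ j ∧ Y j ω ∈ ({(s : ℝ)} : Set ℝ)} := by
    refine IsClosed.csInf_mem ?_ hne (OrderBot.bddBelow _)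
    simp only [zero_le, true_and]
    exact isClosed_singleton.preimage hc
  rw [stoppedValue, levelHittingTime, hittingAfter, if_pos hne]
  exact hmem.2

end IsFractionalBrownian

/-! ### Gaussian moments and continuous modifications. -/

section GaussianModification

variable {Ω : Type*} [MeasurableSpace Ω] {P : Measure Ω}

/-- Reduces all absolute moments to those of the standard normal law, degenerate variables included.
-/
lemma ProbabilityTheory.HasGaussianLaw.hasLaw_map_standard {X : Ω → ℝ} (hX : HasGaussianLaw X P)
    (h0 : ∫ ω, X ω ∂P = 0) :
    HasLaw X ((gaussianReal 0 1).map (√Var[X; P] * ·)) P where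
  aemeasurable := hX.aemeasurable
  map_eq := by
    rw [hX.map_eq_gaussianReal, h0, gaussianReal_map_const_mul, mul_zero, mul_one]
    congr 1
    ext
    simp [Real.sq_sqrt (variance_nonneg X P), variance_nonneg X P]

lemma ProbabilityTheory.HasGaussianLaw.integral_abs {X : Ω → ℝ} (hX : HasGaussianLaw X P)
    (h0 : ∫ ω, X ω ∂P = 0) :
    ∫ ω, |X ω| ∂P = √Var[X; P] * ∫ x, |x| ∂gaussianReal 0 1 := by
  have h := (hX.hasLaw_map_standard h0).integral_comp (f := fun x : ℝ ↦ |x|) (by fun_prop)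
  simp only [Function.comp_def] at h
  rw [h, integral_map (by fun_prop) (by fun_prop), ← integral_const_mul]
  simp [abs_mul, abs_of_nonneg]

lemma ProbabilityTheory.HasGaussianLaw.lintegral_enorm_pow {X : Ω → ℝ} (hX : HasGaussianLaw X P)
    (h0 : ∫ ω, X ω ∂P = 0) (p : ℕ) :
    ∫⁻ ω, ‖X ω‖ₑ ^ p ∂P =
      ENNReal.ofReal (√Var[X; P] ^ p) * ∫⁻ x, ‖x‖ₑ ^ p ∂gaussianReal 0 1 := by
  have h := (hX.hasLaw_map_standard h0).lintegral_comp (f := fun x : ℝ ↦ ‖x‖ₑ ^ p) (by fun_prop)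
  rw [h, lintegral_map (by fun_prop) (by fun_prop), ← lintegral_const_mul _ (by fun_prop)]
  simp_rw [enorm_mul, mul_pow, Real.enorm_of_nonneg (Real.sqrt_nonneg _),
    ENNReal.ofReal_pow (Real.sqrt_nonneg _)]

lemma lintegral_enorm_pow_gaussianReal_ne_top (p : ℕ) :
    ∫⁻ x, ‖x‖ₑ ^ p ∂gaussianReal 0 1 ≠ ∞ := by
  rcases eq_or_ne p 0 with rfl | hp
  · simp
  have h := (memLp_id_gaussianReal (μ := 0) (v := 1) p).eLpNorm_lt_top
  have := lintegral_rpow_enorm_lt_top_of_eLpNorm_lt_top (p := (p : ℝ≥0∞)) (by simpa)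
    (by simp) (by simpa using h)
  simpa using this.ne

lemma integral_abs_gaussianReal_pos : 0 < ∫ x, |x| ∂gaussianReal 0 1 := by
  have hi : Integrable (fun x : ℝ ↦ |x|) (gaussianReal 0 1) :=
    ((memLp_id_gaussianReal (μ := 0) (v := 1) 1).integrable (by simp)).abs
  rw [integral_pos_iff_support_of_nonneg (fun _ ↦ abs_nonneg _) hi]
  have : Function.support (fun x : ℝ ↦ |x|) = {0}ᶜ := by ext; simp
  have hns := nullSingletonClass_gaussianReal (μ := 0) (v := 1) one_ne_zero
  rw [this, prob_compl_eq_one_sub (measurableSet_singleton _)]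
  simp

variable {X : ℝ≥0 → Ω → ℝ} {K h : ℝ}

lemma variance_sub_of_covariance (hX : IsGaussianProcess X P) (hh : 0 < h)
    (hc : ∀ s t : ℝ≥0, cov[X s, X t; P] =
      K / 2 * ((s : ℝ) ^ h + (t : ℝ) ^ h - |(s : ℝ) - t| ^ h)) (s t : ℝ≥0) :
    Var[fun ω ↦ X s ω - X t ω; P] = K * |(s : ℝ) - t| ^ h := by
  have := hX.isProbabilityMeasure
  rw [variance_fun_sub (hX.hasGaussianLaw_eval s).memLp_two (hX.hasGaussianLaw_eval t).memLp_two,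
    ← covariance_self (hX.aemeasurable s), ← covariance_self (hX.aemeasurable t), hc, hc, hc]
  simp only [sub_self, abs_zero, Real.zero_rpow hh.ne']
  ring

/-- A centered Gaussian process with the covariance of a fractional Brownian motion has a
modification with continuous paths. -/
lemma exists_continuous_modification_of_covariance (hX : IsGaussianProcess X P)
    (h0 : ∀ t, ∫ ω, X t ω ∂P = 0) (hh : 0 < h) (hK : 0 ≤ K)
    (hc : ∀ s t : ℝ≥0, cov[X s, X t; P] =
      K / 2 * ((s : ℝ) ^ h + (t : ℝ) ^ h - |(s : ℝ) - t| ^ h)) :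
    ∃ X' : ℝ≥0 → Ω → ℝ, (∀ t, X' t =ᵐ[P] X t) ∧ ∀ᵐ ω ∂P, Continuous fun t ↦ X' t ω := by
  -- The `p`-th moment of an increment is a multiple of `d ^ (h * p / 2)`, at most `d ^ 2` for `d ≤
  -- 1` once `h * p ≥ 4`.
  obtain ⟨p, hp⟩ := exists_nat_gt (4 / h)
  have hp' : 4 ≤ h * p := by
    rw [div_lt_iff₀ hh] at hp
    linarith
  have hp0 : p ≠ 0 := by
    rintro rfl
    norm_num at hp'
  set m := ∫⁻ x, ‖x‖ₑ ^ p ∂gaussianReal 0 1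
  have hm : m ≠ ∞ := lintegral_enorm_pow_gaussianReal_ne_top p
  refine exists_continuous_modification (p := p) (C := (√K ^ p).toNNReal * m.toNNReal) hp0
    hX.aemeasurable fun s t hst ↦ ?_
  rw [hX.hasGaussianLaw_fun_sub.lintegral_enorm_pow (by
    rw [integral_sub (hX.hasGaussianLaw_eval s).integrable (hX.hasGaussianLaw_eval t).integrable,
      h0, h0, sub_zero]), variance_sub_of_covariance hX hh hc]
  rw [ENNReal.coe_mul, ENNReal.coe_toNNReal hm, mul_right_comm]
  gcongr
  change _ ≤ ENNReal.ofReal (√K ^ p) * _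
  rw [← ENNReal.ofReal_mul (by positivity)]
  gcongr
  rw [Real.sqrt_mul hK, mul_pow]
  gcongr
  set d := |(s : ℝ) - t|
  have hd : 0 ≤ d := abs_nonneg _
  rcases hd.eq_or_lt with hd0 | hd0
  · rw [← hd0, Real.zero_rpow hh.ne', Real.sqrt_zero, zero_pow hp0]
    positivity
  · rw [Real.sqrt_eq_rpow, ← Real.rpow_mul hd, ← Real.rpow_mul_natCast hd, ← Real.rpow_natCast d 2]
    refine Real.rpow_le_rpow_of_exponent_ge hd0 hst ?_
    push_cast
    linarith

lemma integral_abs_sub_eq (hX : IsGaussianProcess X P) (h0 : ∀ t, ∫ ω, X t ω ∂P = 0)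
    (hh : 0 < h) (hK : 0 ≤ K)
    (hc : ∀ s t : ℝ≥0, cov[X s, X t; P] =
      K / 2 * ((s : ℝ) ^ (2 * h) + (t : ℝ) ^ (2 * h) - |(s : ℝ) - t| ^ (2 * h))) (s t : ℝ≥0) :
    ∫ ω, |X s ω - X t ω| ∂P = √K * (∫ x, |x| ∂gaussianReal 0 1) * |(s : ℝ) - t| ^ h := by
  rw [hX.hasGaussianLaw_fun_sub.integral_abs (by
    rw [integral_sub (hX.hasGaussianLaw_eval s).integrable (hX.hasGaussianLaw_eval t).integrable,
      h0, h0, sub_zero]), variance_sub_of_covariance hX (by linarith) hc, Real.sqrt_mul hK, two_mul,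
    Real.rpow_add_of_nonneg (abs_nonneg _) hh.le hh.le,
    Real.sqrt_mul_self (Real.rpow_nonneg (abs_nonneg _) _)]
  ring

end GaussianModification

/-! ### First absolute moments of fractional Brownian motion. -/

namespace IsFractionalBrownian

variable {Ω : Type*} [MeasurableSpace Ω] {P : Measure Ω} {Y : ℝ≥0 → Ω → ℝ} {H v : ℝ}

lemma integral_abs_one_eq (hY : IsFractionalBrownian Y H v P) :
    ∫ ω, |Y 1 ω| ∂P = √v * ∫ x, |x| ∂gaussianReal 0 1 := by
  rw [(hY.isGaussianProcess.hasGaussianLaw_eval 1).integral_abs (hY.mean_zero 1), hY.variance_eq]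
  simp

lemma integral_abs_one_pos (hY : IsFractionalBrownian Y H v P) : 0 < ∫ ω, |Y 1 ω| ∂P := by
  rw [hY.integral_abs_one_eq]
  exact mul_pos (Real.sqrt_pos.2 hY.var_pos) integral_abs_gaussianReal_pos

lemma integral_abs_sub (hY : IsFractionalBrownian Y H v P) (s t : ℝ≥0) :
    ∫ ω, |Y s ω - Y t ω| ∂P = (∫ ω, |Y 1 ω| ∂P) * |(s : ℝ) - t| ^ H := by
  rw [hY.integral_abs_one_eq]
  exact integral_abs_sub_eq hY.isGaussianProcess hY.mean_zero hY.hurst_pos hY.var_pos.le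
    hY.covariance_eq s t

lemma integral_abs (hY : IsFractionalBrownian Y H v P) (t : ℝ≥0) :
    ∫ ω, |Y t ω| ∂P = (∫ ω, |Y 1 ω| ∂P) * (t : ℝ) ^ H := by
  have h := hY.integral_abs_sub t 0
  rw [NNReal.coe_zero, sub_zero, NNReal.abs_eq] at h
  rw [← h]
  refine integral_congr_ae ?_
  filter_upwards [hY.zero_ae_eq_zero] with ω hω
  rw [hω, sub_zero]

end IsFractionalBrownian

/-! ### Regions under random variables and their measure. -/

section IndicatorRegion

/-- Both sides are `min |a| |b|` for equal signs and `0` for opposite ones. This form turns absolute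
moments of increments into a covariance. -/
lemma volume_uIcc_inter_uIcc (a b : ℝ) :
    volume (uIcc 0 a ∩ uIcc 0 b) = ENNReal.ofReal ((|a| + |b| - |a - b|) / 2) := by
  rw [uIcc, uIcc, Icc_inter_Icc, Real.volume_Icc]
  congr 1
  rcases le_total 0 a with ha | ha <;> rcases le_total 0 b with hb | hb <;>
    rcases le_total a b with hab | hab <;>
    simp [ha, hb, hab, abs_of_nonneg, abs_of_nonpos] <;> linarith

/-- The set of points `(ω, x)` such that `x` lies between `0` and `Z ω`. -/
def indicatorRegion {Ω' : Type*} (Z : Ω' → ℝ) : Set (Ω' × ℝ) := {p | p.2 ∈ uIcc 0 (Z p.1)}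

variable {Ω' : Type*} [MeasurableSpace Ω'] {P' : Measure Ω'} {Z Z' : Ω' → ℝ}

lemma measurableSet_indicatorRegion (hZ : Measurable Z) : MeasurableSet (indicatorRegion Z) := by
  have hZ' : Measurable fun p : Ω' × ℝ ↦ Z p.1 := hZ.comp measurable_fst
  exact (measurableSet_le (measurable_const.min hZ') measurable_snd).inter
    (measurableSet_le measurable_snd (measurable_const.max hZ'))

lemma measure_indicatorRegion_inter (hZ : Measurable Z) (hZ' : Measurable Z') :
    (P'.prod volume) (indicatorRegion Z ∩ indicatorRegion Z') =
      ∫⁻ ω, ENNReal.ofReal ((|Z ω| + |Z' ω| - |Z ω - Z' ω|) / 2) ∂P' := by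
  rw [Measure.prod_apply
    ((measurableSet_indicatorRegion hZ).inter (measurableSet_indicatorRegion hZ'))]
  exact lintegral_congr fun ω ↦ volume_uIcc_inter_uIcc (Z ω) (Z' ω)

lemma measure_indicatorRegion_lt_top (hZ : Measurable Z) (hi : Integrable Z P') :
    (P'.prod volume) (indicatorRegion Z) < ∞ := by
  have h := measure_indicatorRegion_inter (P' := P') hZ hZ
  rw [inter_self] at h
  rw [h]
  refine lt_of_le_of_lt (lintegral_mono fun ω ↦ ?_) hi.hasFiniteIntegral
  rw [← Real.enorm_abs, Real.enorm_of_nonneg (abs_nonneg _)]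
  simp

lemma measureReal_indicatorRegion_inter (hZ : Measurable Z) (hZ' : Measurable Z')
    (hi : Integrable Z P') (hi' : Integrable Z' P') :
    (P'.prod volume).real (indicatorRegion Z ∩ indicatorRegion Z') =
      (∫ ω, |Z ω| ∂P' + ∫ ω, |Z' ω| ∂P' - ∫ ω, |Z ω - Z' ω| ∂P') / 2 := by
  have hd : Integrable (fun ω ↦ |Z ω - Z' ω|) P' := (hi.sub hi').abs
  rw [Measure.real, measure_indicatorRegion_inter hZ hZ', ← integral_eq_lintegral_of_nonneg_ae,
    integral_div, integral_sub (hi.abs.fun_add hi'.abs) hd,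
    integral_add hi.abs hi'.abs]
  · refine ae_of_all _ fun ω ↦ ?_
    have := abs_sub (Z ω) (Z' ω)
    simp only [Pi.zero_apply]
    linarith
  · exact Measurable.aestronglyMeasurable (by fun_prop)

lemma indicatorKernel_ae_eq [SFinite P'] (h : Z =ᵐ[P'] Z') :
    indicatorKernel Z =ᵐ[P'.prod volume] (indicatorRegion Z').indicator fun _ ↦ 1 := by
  filter_upwards [Measure.quasiMeasurePreserving_fst.ae h] with p hp
  simp only [indicatorKernel, hp]
  rfl

end IndicatorRegion

/-! ### The Gaussian process indexed by regions, and the main theorem. -/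

section RegionProcess

variable {Ω Ω' : Type*} [MeasurableSpace Ω] [MeasurableSpace Ω']
  {P : Measure Ω} [IsProbabilityMeasure P] {P' : Measure Ω'} {M : Set (Ω' × ℝ) → Ω → ℝ}

namespace IsGaussianRandomMeasure

omit [IsProbabilityMeasure P] in
lemma isStochasticIntegral_indicatorKernel [SFinite P']
    (hM : IsGaussianRandomMeasure M (P'.prod volume) P) {Z Z' : Ω' → ℝ} (hZ' : Measurable Z')
    (hi : Integrable Z' P') (h : Z =ᵐ[P'] Z') :
    IsStochasticIntegral M (P'.prod volume) P (indicatorKernel Z) (M (indicatorRegion Z')) :=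
  hM.isStochasticIntegral_of_ae_eq_indicator (measurableSet_indicatorRegion hZ')
    (measure_indicatorRegion_lt_top hZ' hi) (indicatorKernel_ae_eq h)

/-- The process of the values of a Gaussian random measure on the regions below a family `Z` whose
increments have absolute moments `K * |s - t| ^ h` is Gaussian with the covariance of fractional
Brownian motion, and has a continuous modification. -/
lemma exists_continuous_modification_indicatorRegion
    (hM : IsGaussianRandomMeasure M (P'.prod volume) P) {Z : ℝ≥0 → Ω' → ℝ} {K h : ℝ}
    (hh : 0 < h) (hK : 0 ≤ K) (hZ : ∀ t, Measurable (Z t)) (hi : ∀ t, Integrable (Z t) P')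
    (h1 : ∀ t : ℝ≥0, ∫ ω, |Z t ω| ∂P' = K * (t : ℝ) ^ h)
    (h2 : ∀ s t : ℝ≥0, ∫ ω, |Z s ω - Z t ω| ∂P' = K * |(s : ℝ) - t| ^ h) :
    ∃ X : ℝ≥0 → Ω → ℝ, (∀ t, X t =ᵐ[P] M (indicatorRegion (Z t))) ∧
      IsGaussianProcess X P ∧ (∀ t, ∫ ω, X t ω ∂P = 0) ∧
      (∀ s t : ℝ≥0, cov[X s, X t; P] =
        K / 2 * ((s : ℝ) ^ h + (t : ℝ) ^ h - |(s : ℝ) - t| ^ h)) ∧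
      ∀ᵐ ω ∂P, Continuous fun t ↦ X t ω := by
  have hR := fun t ↦ measurableSet_indicatorRegion (hZ t)
  have hmR := fun t ↦ measure_indicatorRegion_lt_top (hZ t) (hi t)
  have hG := hM.isGaussianProcess hR hmR
  have h0 : ∀ t, ∫ ω, M (indicatorRegion (Z t)) ω ∂P = 0 :=
    fun t ↦ hM.integral_eq_zero (hR t) (hmR t)
  have hc : ∀ s t : ℝ≥0, cov[M (indicatorRegion (Z s)), M (indicatorRegion (Z t)); P] =
      K / 2 * ((s : ℝ) ^ h + (t : ℝ) ^ h - |(s : ℝ) - t| ^ h) := fun s t ↦ by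
    rw [hM.covariance_eq (hR s) (hR t) (hmR s) (hmR t),
      measureReal_indicatorRegion_inter (hZ s) (hZ t) (hi s) (hi t), h1, h1, h2]
    ring
  obtain ⟨X, hX, hcont⟩ := exists_continuous_modification_of_covariance hG h0 hh hK hc
  refine ⟨X, hX, hG.congr fun t ↦ (hX t).symm, fun t ↦ ?_, fun s t ↦ ?_, hcont⟩
  · rw [integral_congr_ae (hX t), h0]
  · rw [covariance_congr_ae (hX s) (hX t), hc]

end IsGaussianRandomMeasure

end RegionProcess

lemma indicatorRegion_const {Ω' : Type*} (t : ℝ≥0) :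
    indicatorRegion (fun _ : Ω' ↦ (t : ℝ)) = univ ×ˢ Icc (0 : ℝ) t := by
  ext p
  simp [indicatorRegion, uIcc_of_le]

theorem proposition7 {Ω Ω' : Type*} [MeasurableSpace Ω] [MeasurableSpace Ω']
    (P : Measure Ω) [IsProbabilityMeasure P] (P' : Measure Ω') [IsProbabilityMeasure P']
    (Y : ℝ≥0 → Ω' → ℝ) (H v : ℝ) (hY : IsFractionalBrownian Y H v P')
    (M : Set (Ω' × ℝ) → Ω → ℝ) (hM : IsGaussianRandomMeasure M (P'.prod volume) P) :
    -- every nonnegative level is hit almost surely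
    (∀ s : ℝ≥0, ∀ᵐ ω' ∂P', levelHittingTime Y s ω' < ⊤) ∧
    -- the two families of integrals exist
    (∀ t : ℝ≥0, IsStochasticIntegral M (P'.prod volume) P (indicatorKernel (Y t))
      (indicatorMotion M P P' Y t)) ∧
    (∀ t : ℝ≥0, IsStochasticIntegral M (P'.prod volume) P
      (indicatorKernel (stoppedValue Y (levelHittingTime Y t)))
      (timeChangedIndicatorMotion M P P' Y t)) ∧
    -- the indicator motion is (up to modification) an fBm with Hurst exponent below one half
    (H / 2 < 1 / 2 ∧
      ∃ X : ℝ≥0 → Ω → ℝ, IsFractionalBrownian X (H / 2) (∫ ω', |Y 1 ω'| ∂P') P ∧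
        ∀ t : ℝ≥0, X t =ᵐ[P] indicatorMotion M P P' Y t) ∧
    -- the time-changed integral at time `t` is the random measure of `Ω' × [0, t]`
    (∀ t : ℝ≥0, timeChangedIndicatorMotion M P P' Y t =ᵐ[P]
      M ((univ : Set Ω') ×ˢ Icc (0 : ℝ) t)) ∧
    -- the time-changed process is (up to modification) a Brownian motion
    (∃ B : ℝ≥0 → Ω → ℝ, IsBrownianReal B P ∧
      ∀ t : ℝ≥0, B t =ᵐ[P] timeChangedIndicatorMotion M P P' Y t) := by
  have hYm := hY.isGaussianProcess.aemeasurable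
  have hYi : ∀ t, Integrable (Y t) P' := fun t ↦
    (hY.isGaussianProcess.hasGaussianLaw_eval t).integrable
  -- `Y t` is only almost everywhere measurable, while `M` is controlled on measurable sets; hence
  -- measurable versions.
  let Z : ℝ≥0 → Ω' → ℝ := fun t ↦ (hYm t).mk (Y t)
  have hZm : ∀ t, Measurable (Z t) := fun t ↦ (hYm t).measurable_mk
  have hYZ : ∀ t, Y t =ᵐ[P'] Z t := fun t ↦ (hYm t).ae_eq_mk
  have hZi : ∀ t, Integrable (Z t) P' := fun t ↦ (hYi t).congr (hYZ t)
  have hint : ∀ t, IsStochasticIntegral M (P'.prod volume) P (indicatorKernel (Y t))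
      (M (indicatorRegion (Z t))) := fun t ↦
    hM.isStochasticIntegral_indicatorKernel (hZm t) (hZi t) (hYZ t)
  have hintτ : ∀ t : ℝ≥0, IsStochasticIntegral M (P'.prod volume) P
      (indicatorKernel (stoppedValue Y (levelHittingTime Y t)))
      (M (indicatorRegion fun _ ↦ (t : ℝ))) := fun t ↦
    hM.isStochasticIntegral_indicatorKernel measurable_const (integrable_const _)
      (hY.ae_stoppedValue_levelHittingTime t)
  have hmotion := fun t ↦ isStochasticIntegral_stochasticIntegral (hint t)
  have hmotionτ := fun t ↦ isStochasticIntegral_stochasticIntegral (hintτ t)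
  refine ⟨hY.ae_levelHittingTime_lt_top, hmotion, hmotionτ,
    ⟨by linarith [hY.hurst_lt_one], ?_⟩, fun t ↦ ?_, ?_⟩
  · obtain ⟨X, hX, hXG, hX0, hXc, hXcont⟩ := hM.exists_continuous_modification_indicatorRegion
      hY.hurst_pos hY.integral_abs_one_pos.le hZm hZi (fun t ↦ by
        rw [← hY.integral_abs t]
        refine integral_congr_ae ?_
        filter_upwards [hYZ t] with ω hω
        rw [hω]) (fun s t ↦ by
        rw [← hY.integral_abs_sub s t]
        refine integral_congr_ae ?_
        filter_upwards [hYZ s, hYZ t] with ω hs ht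
        rw [hs, ht])
    refine ⟨X, ⟨by linarith [hY.hurst_pos], by linarith [hY.hurst_lt_one, hY.hurst_pos],
      hY.integral_abs_one_pos, hXG, hX0, fun s t ↦ ?_, hXcont⟩,
      fun t ↦ (hX t).trans ((hint t).ae_eq hM (hmotion t))⟩
    rw [hXc, mul_div_cancel₀ _ two_ne_zero]
  · rw [← indicatorRegion_const]
    exact (hmotionτ t).ae_eq hM (hintτ t)
  -- The deterministic family `Z t = t` has `K = 1` and `h = 1`, and the covariance formula reduces
  -- to `min s t`.
  · obtain ⟨B, hB, hBG, hB0, hBc, hBcont⟩ := hM.exists_continuous_modification_indicatorRegion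
      (Z := fun t _ ↦ (t : ℝ)) one_pos zero_le_one (fun t ↦ measurable_const)
      (fun t ↦ integrable_const _) (fun t ↦ by simp) (fun s t ↦ by simp)
    refine ⟨B, ⟨hBG.isPreBrownianReal_of_covariance hB0 fun s t hst ↦ ?_, hBcont⟩,
      fun t ↦ (hB t).trans ((hintτ t).ae_eq hM (hmotionτ t))⟩
    have hst' : (s : ℝ) ≤ t := hst
    rw [hBc, Real.rpow_one, Real.rpow_one, Real.rpow_one, abs_sub_comm,
      abs_of_nonneg (sub_nonneg.2 hst')]
    ring
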